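/- Let $N\ge 1$ and let $\Omega\subset\mathbb R^N$ be a bounded domain with $C^\infty$ boundary $\Gamma=\partial\Omega$ and outward unit normal $n$; write $\Gamma(r)=\{x\in\mathbb R^N:\operatorname{dist}(x,\Gamma)\le r\}$. There exists $\delta_0>0$, depending only on $\Omega$, such that every $x\in\Gamma(\delta_0)$ has a unique representation $x=\bar x+t\,n(\bar x)$ with $\bar x\in\Gamma$ and $t\in[-\delta_0,\delta_0]$ (put $\pi(x):=\bar x$), and such that the following holds. For every $c>0$ there is $h_0>0$ such that for all $C_{0E}>0$ and $p\in[1,\infty]$ there is a constant $C>0$ (depending only on $\Omega$, $N$, $c$, $C_{0E}$, $p$) with the following property. Let $\mathcal T_h$ be a finite face-to-face triangulation into closed $N$-simplices, with mesh size $h=\max_{T\in\mathcal T_h}\operatorname{diam}T\le h_0$, of a polyhedral domain $\Omega_h$ (the interior of $\bigcup_{T\in\mathcal T_h}T$, assumed connected), $\Gamma_h:=\partial\Omega_h$, such that * every $T\in\mathcal T_h$ contains a ball of radius $ch$ and is contained in a ball of radius $h$; * the vertices of every $(N-1)$-dimensional face of the triangulation that is contained in $\Gamma_h$ lie on $\Gamma$;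 * $\Omega_h\setminus\Omega\subset\Gamma(\delta_0)$, so that $\pi$ is defined on $\Omega_h\setminus\Omega$. Put $\delta:=C_{0E}h^2$. Then for every $f\in W^{1,p}(\Omega_h)$, $$\|f\|_{L^p(\Omega_h\setminus\Omega)}\le C\Big(\delta^{1/p}\,\|f\|_{L^p(\Gamma_h)}+\delta\,\|(n\circ\pi)\cdot\nabla f\|_{L^p(\Omega_h\setminus\Omega)}\Big),$$ where $\delta^{1/\infty}:=1$ and $f$ on $\Gamma_h$ is understood in the sense of traces, that is, as the limit in $L^1(\Gamma_h)$ of the restrictions to $\Gamma_h$ of smooth functions on $\mathbb R^N$ converging to $f$ in $W^{1,1}(\Omega_h)$. In particular $C$ is independent of $h$, $\delta$, $\mathcal T_h$ and $f$. -/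

import Mathlib

open MeasureTheory Filter Topology
open scoped ENNReal ContDiff

noncomputable section

namespace BoundarySkin

variable {N : ℕ}

/-! ### The smooth domain, its outward normal and the projection onto its boundary -/

/-- `ρ` is a smooth defining function of `Ω` in a neighbourhood of the point `x`: near `x` the set
`Ω` is `{ρ < 0}`, and the gradient of `ρ` does not vanish at `x`. -/
def IsLocalDefiningFunction (Ω : Set (EuclideanSpace ℝ (Fin N))) (x : EuclideanSpace ℝ (Fin N))
    (ρ : EuclideanSpace ℝ (Fin N) → ℝ) : Prop :=
  ContDiff ℝ ∞ ρ ∧ gradient ρ x ≠ 0 ∧ ∀ᶠ y in 𝓝 x, (y ∈ Ω ↔ ρ y < 0)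

/-- A bounded domain of class `C^∞`. -/
structure IsBoundedSmoothDomain (Ω : Set (EuclideanSpace ℝ (Fin N))) : Prop where
  isOpen : IsOpen Ω
  isConnected : IsConnected Ω
  isBounded : Bornology.IsBounded Ω
  smooth : ∀ x ∈ frontier Ω, ∃ ρ, IsLocalDefiningFunction Ω x ρ

/-- `ν` is the outward unit normal to the boundary of `Ω` at `x`. -/
def IsOutwardUnitNormal (Ω : Set (EuclideanSpace ℝ (Fin N)))
    (x ν : EuclideanSpace ℝ (Fin N)) : Prop :=
  ∃ ρ, IsLocalDefiningFunction Ω x ρ ∧ ν = ‖gradient ρ x‖⁻¹ • gradient ρ x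

/-- The outward unit normal field `n` (meaningful at the points of the smooth boundary of `Ω`). -/
def outwardNormal (Ω : Set (EuclideanSpace ℝ (Fin N))) (x : EuclideanSpace ℝ (Fin N)) :
    EuclideanSpace ℝ (Fin N) :=
  Classical.epsilon (IsOutwardUnitNormal Ω x)

theorem IsBoundedSmoothDomain.isOutwardUnitNormal {Ω : Set (EuclideanSpace ℝ (Fin N))}
    (hΩ : IsBoundedSmoothDomain Ω) {x : EuclideanSpace ℝ (Fin N)} (hx : x ∈ frontier Ω) :
    IsOutwardUnitNormal Ω x (outwardNormal Ω x) := by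
  obtain ⟨ρ, hρ⟩ := hΩ.smooth x hx
  exact Classical.epsilon_spec (p := IsOutwardUnitNormal Ω x) ⟨_, ρ, hρ, rfl⟩

/-- The tubular neighbourhood `Γ(δ) = {x | dist(x, Γ) ≤ δ}` of the boundary `Γ` of `Ω`. -/
def tube (Ω : Set (EuclideanSpace ℝ (Fin N))) (δ : ℝ) : Set (EuclideanSpace ℝ (Fin N)) :=
  Metric.cthickening δ (frontier Ω)

/-- `x = x̄ + t n(x̄)` with `x̄ ∈ Γ` and `t ∈ [-δ, δ]`. -/
def IsTubularRep (Ω : Set (EuclideanSpace ℝ (Fin N))) (δ : ℝ) (x xbar : EuclideanSpace ℝ (Fin N))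
    (t : ℝ) : Prop :=
  xbar ∈ frontier Ω ∧ t ∈ Set.Icc (-δ) δ ∧ x = xbar + t • outwardNormal Ω xbar

/-- Each point of `Γ(δ)` has a unique representation `x = x̄ + t n(x̄)`, `x̄ ∈ Γ`, `|t| ≤ δ`. -/
def IsTubularRadius (Ω : Set (EuclideanSpace ℝ (Fin N))) (δ : ℝ) : Prop :=
  ∀ x ∈ tube Ω δ, ∃! q : EuclideanSpace ℝ (Fin N) × ℝ, IsTubularRep Ω δ x q.1 q.2

/-- The projection `π : x ↦ x̄` from `Γ(δ)` to `Γ` (meaningful on `Γ(δ)` when `δ` is a tubular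
radius). -/
def proj (Ω : Set (EuclideanSpace ℝ (Fin N))) (δ : ℝ) (x : EuclideanSpace ℝ (Fin N)) :
    EuclideanSpace ℝ (Fin N) :=
  Classical.epsilon fun xbar => ∃ t, IsTubularRep Ω δ x xbar t

theorem IsTubularRadius.proj_spec {Ω : Set (EuclideanSpace ℝ (Fin N))} {δ : ℝ}
    (h : IsTubularRadius Ω δ) {x : EuclideanSpace ℝ (Fin N)} (hx : x ∈ tube Ω δ) :
    ∃ t, IsTubularRep Ω δ x (proj Ω δ x) t := by
  obtain ⟨q, hq, -⟩ := h x hx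
  exact Classical.epsilon_spec (p := fun xbar => ∃ t, IsTubularRep Ω δ x xbar t) ⟨q.1, q.2, hq⟩

/-! ### Triangulations and polyhedral domains -/

/-- The elements `T` of a triangulation: its `N`-dimensional simplices (given by their vertices). -/
def cells (K : Geometry.SimplicialComplex ℝ (EuclideanSpace ℝ (Fin N))) :
    Set (Finset (EuclideanSpace ℝ (Fin N))) :=
  {s | s ∈ K.faces ∧ s.card = N + 1}

/-- The mesh size `h`, the maximum of the diameters of the elements. -/
def meshSize (K : Geometry.SimplicialComplex ℝ (EuclideanSpace ℝ (Fin N))) : ℝ :=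
  sSup ((fun s : Finset (EuclideanSpace ℝ (Fin N)) =>
    Metric.diam (convexHull ℝ (s : Set (EuclideanSpace ℝ (Fin N))))) '' cells K)

/-- The polyhedral domain `Ω_h` that is triangulated: the interior of the union of all (closed)
simplices. -/
def polyDomain (K : Geometry.SimplicialComplex ℝ (EuclideanSpace ℝ (Fin N))) :
    Set (EuclideanSpace ℝ (Fin N)) :=
  interior K.space

/-- The boundary mesh: the `(N-1)`-dimensional faces that are contained in `Γ_h = ∂Ω_h`. -/
def boundaryFaces (K : Geometry.SimplicialComplex ℝ (EuclideanSpace ℝ (Fin N))) :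
    Set (Finset (EuclideanSpace ℝ (Fin N))) :=
  {s | s ∈ K.faces ∧ s.card = N ∧
    convexHull ℝ (s : Set (EuclideanSpace ℝ (Fin N))) ⊆ frontier (polyDomain K)}

/-- `K` is a finite (face-to-face) triangulation of a polyhedral domain into `N`-simplices, it is
quasi-uniform with constant `c`, and the vertices of its boundary faces lie on `Γ = ∂Ω`. -/
structure IsAdmissibleMesh (Ω : Set (EuclideanSpace ℝ (Fin N))) (c : ℝ)
    (K : Geometry.SimplicialComplex ℝ (EuclideanSpace ℝ (Fin N))) : Prop where
  finite : K.faces.Finite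
  pure : ∀ s ∈ K.faces, ∃ t ∈ cells K, s ⊆ t
  isConnected : IsConnected (polyDomain K)
  ball_subset : ∀ s ∈ cells K, ∃ x : EuclideanSpace ℝ (Fin N),
    Metric.ball x (c * meshSize K) ⊆ convexHull ℝ (s : Set (EuclideanSpace ℝ (Fin N)))
  subset_ball : ∀ s ∈ cells K, ∃ x : EuclideanSpace ℝ (Fin N),
    convexHull ℝ (s : Set (EuclideanSpace ℝ (Fin N))) ⊆ Metric.closedBall x (meshSize K)
  boundary : ∀ s ∈ boundaryFaces K, (s : Set (EuclideanSpace ℝ (Fin N))) ⊆ frontier Ω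

/-! ### Sobolev functions and traces -/

/-- `f ∈ W^{1,p}(U)`, with weak gradient `G`. -/
structure IsSobolev (U : Set (EuclideanSpace ℝ (Fin N))) (p : ℝ≥0∞)
    (f : EuclideanSpace ℝ (Fin N) → ℝ) (G : EuclideanSpace ℝ (Fin N) → EuclideanSpace ℝ (Fin N)) :
    Prop where
  memLp : MemLp f p (volume.restrict U)
  memLp_grad : MemLp G p (volume.restrict U)
  weak : ∀ φ : EuclideanSpace ℝ (Fin N) → ℝ, ContDiff ℝ ∞ φ → HasCompactSupport φ →
    tsupport φ ⊆ U → ∀ v : EuclideanSpace ℝ (Fin N),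
      ∫ x in U, f x * fderiv ℝ φ x v = -∫ x in U, inner ℝ (G x) v * φ x

/-- The surface measure on the boundary of `U`: the `(N-1)`-dimensional Hausdorff measure,
normalized so as to agree with the Lebesgue measure on hyperplanes. -/
def surfaceMeasure (U : Set (EuclideanSpace ℝ (Fin N))) : Measure (EuclideanSpace ℝ (Fin N)) :=
  (Measure.euclideanHausdorffMeasure (N - 1)).restrict (frontier U)

/-- `g` is the trace on `∂U` of the function `f` with weak gradient `G`: the limit in `L^1(∂U)` of
the restrictions to `∂U` of functions that are smooth up to the boundary and converge to `f` in
`W^{1,1}(U)`. (On a bounded `U` this covers all `W^{1,p}(U)`, `1 ≤ p ≤ ∞`.) -/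
def IsTrace (U : Set (EuclideanSpace ℝ (Fin N)))
    (f : EuclideanSpace ℝ (Fin N) → ℝ) (G : EuclideanSpace ℝ (Fin N) → EuclideanSpace ℝ (Fin N))
    (g : EuclideanSpace ℝ (Fin N) → ℝ) : Prop :=
  AEStronglyMeasurable g (surfaceMeasure U) ∧
  ∃ φ : ℕ → EuclideanSpace ℝ (Fin N) → ℝ, (∀ k, ContDiff ℝ ∞ (φ k)) ∧
    Tendsto (fun k => eLpNorm (fun x => φ k x - f x) 1 (volume.restrict U)) atTop (𝓝 0) ∧
    Tendsto (fun k => eLpNorm (fun x => gradient (φ k) x - G x) 1 (volume.restrict U))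
      atTop (𝓝 0) ∧
    Tendsto (fun k => eLpNorm (fun x => φ k x - g x) 1 (surfaceMeasure U)) atTop (𝓝 0)

end BoundarySkin

end

open MeasureTheory Filter Topology
open scoped ENNReal ContDiff

noncomputable section

namespace BoundarySkin

variable {N : ℕ}

local notation "E" => EuclideanSpace ℝ (Fin N)

section

/-! ### The outward unit normal -/

/-! From a point `x` of the skin Ω_h \ Ω, move outwards along the normal line through `x` until Ω_h
is left, at a point e(x) of Γ_h. If this takes time at most σ, the fundamental theorem of calculus
bounds |φ(x)| by |φ(e(x))| plus the integral of |n·∇φ| over a segment of length σ. With σ of order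
h², three facts turn this into the estimate.

Travel time. Γ deviates quadratically from its tangent planes (`exists_abs_inner_le`), so a simplex
of diameter at most h with vertices on Γ stays within 4κh² of Γ (`abs_le_of_mem_boundaryFace`).
Almost every `x` exits through a boundary face, because the (N-2)-skeleton is null for the surface
measure and so is its preimage under e (`ae_exitTime_le`).

Push-forwards. Points that end in a set of diameter ε lie in a thin tube of length σ and volume of
order σε^(N-1); hence the image of dx under e is at most Cσ times the surface measure
(`exists_map_le_euclideanHausdorffMeasure`). For fixed s the motion has the Lipschitz left inverse y
↦ y - s m(y); hence the image of dx ds is at most Cσ dy (`map_prod_le`). Γ_h is never parametrized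
over Γ.

Sobolev functions. The smooth estimate passes to the limit in L¹ and becomes an inequality almost
everywhere for f and its trace (`ae_enorm_le`). L^p norms are taken only afterwards, which covers p
= ∞ as well. -/

theorem ContDiff.hasFDerivAt_inner_gradient {F : Type*} [NormedAddCommGroup F]
    [InnerProductSpace ℝ F] [CompleteSpace F] {ρ : F → ℝ} (h : ContDiff ℝ ∞ ρ) (x : F) :
    HasFDerivAt ρ (innerSL ℝ (gradient ρ x)) x := by
  exact (h.differentiable (by simp) x).hasGradientAt.hasFDerivAt

theorem ContDiff.gradient {F : Type*} [NormedAddCommGroup F]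
    [InnerProductSpace ℝ F] [CompleteSpace F] {ρ : F → ℝ} (h : ContDiff ℝ ∞ ρ) :
    ContDiff ℝ ∞ (gradient ρ) := by
  have h1 : ContDiff ℝ ∞ (fderiv ℝ ρ) := h.fderiv_right (by simp)
  exact ((InnerProductSpace.toDual ℝ F).symm.toContinuousLinearEquiv.contDiff).comp h1

theorem hasDerivAt_comp_line {ρ : E → ℝ} (h : ContDiff ℝ ∞ ρ) (x v : E) (s : ℝ) :
    HasDerivAt (fun t : ℝ => ρ (x + t • v)) (inner ℝ (gradient ρ (x + s • v)) v) s := by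
  have h1 : HasDerivAt (fun t : ℝ => x + t • v) v s := by
    simpa using ((hasDerivAt_id s).smul_const v).const_add x
  exact (ContDiff.hasFDerivAt_inner_gradient h (x + s • v)).comp_hasDerivAt s h1

variable {Ω : Set (EuclideanSpace ℝ (Fin N))} {x : EuclideanSpace ℝ (Fin N)}
  {ρ ρ' : EuclideanSpace ℝ (Fin N) → ℝ}

theorem notMem_of_mem_frontier (hΩ : IsOpen Ω) (hx : x ∈ frontier Ω) : x ∉ Ω := by
  rw [hΩ.frontier_eq] at hx
  exact hx.2

theorem IsLocalDefiningFunction.eq_zero (h : IsLocalDefiningFunction Ω x ρ) (hΩ : IsOpen Ω)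
    (hx : x ∈ frontier Ω) : ρ x = 0 := by
  have h2 : (x ∈ Ω ↔ ρ x < 0) := h.2.2.self_of_nhds
  have h3 := notMem_of_mem_frontier hΩ hx
  refine le_antisymm ?_ (not_lt.1 fun h4 => h3 (h2.2 h4))
  by_contra! h4
  have h5 : ∀ᶠ y in 𝓝 x, 0 < ρ y := h.1.continuous.continuousAt.eventually (lt_mem_nhds h4)
  have h6 : ∃ᶠ y in 𝓝 x, y ∈ Ω := mem_closure_iff_frequently.1 (frontier_subset_closure hx)
  obtain ⟨y, hy, hy2, hy3⟩ := (h6.and_eventually (h5.and h.2.2)).exists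
  exact absurd (hy3.1 hy) (not_lt.2 hy2.le)

theorem IsLocalDefiningFunction.eventually (h : IsLocalDefiningFunction Ω x ρ) :
    ∀ᶠ y in 𝓝 x, IsLocalDefiningFunction Ω y ρ := by
  have h1 : ∀ᶠ y in 𝓝 x, gradient ρ y ≠ 0 :=
    (ContDiff.gradient h.1).continuous.continuousAt.eventually_ne h.2.1
  filter_upwards [h1, h.2.2.eventually_nhds] with y hy hy2
  exact ⟨h.1, hy, hy2⟩

theorem tendsto_line (x v : E) : Tendsto (fun t : ℝ => x + t • v) (𝓝[>] 0) (𝓝 x) := by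
  have h : Continuous (fun t : ℝ => x + t • v) := by fun_prop
  simpa using (h.tendsto 0).mono_left nhdsWithin_le_nhds

/-- Along the ray ρ starts at 0 with negative slope. Together with `inner_nonpos` this describes the
normal through Ω alone, whatever ρ is. -/
theorem IsLocalDefiningFunction.eventually_mem (h : IsLocalDefiningFunction Ω x ρ) (hΩ : IsOpen Ω)
    (hx : x ∈ frontier Ω) {v : E} (hv : inner ℝ (gradient ρ x) v < 0) :
    ∀ᶠ t : ℝ in 𝓝[>] 0, x + t • v ∈ Ω := by
  have h1 := hasDerivAt_comp_line h.1 x v 0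
  simp only [zero_smul, add_zero] at h1
  have h2 := (hasDerivAt_iff_tendsto_slope.1 h1).eventually (gt_mem_nhds hv)
  have h3 : ∀ᶠ t : ℝ in 𝓝[>] 0, slope (fun t : ℝ => ρ (x + t • v)) 0 t < 0 :=
    h2.filter_mono (nhdsWithin_mono _ fun t ht => ne_of_gt ht)
  filter_upwards [h3, (tendsto_line x v).eventually h.2.2, self_mem_nhdsWithin] with t ht ht2 ht3
  rw [ht2]
  rw [slope_def_field] at ht
  simp only [zero_smul, add_zero, sub_zero, h.eq_zero hΩ hx] at ht
  have ht3 : 0 < t := ht3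
  exact (div_neg_iff.1 ht).resolve_left (fun h => absurd h.2 (not_lt.2 ht3.le)) |>.1

theorem IsLocalDefiningFunction.inner_nonpos (h : IsLocalDefiningFunction Ω x ρ) (hΩ : IsOpen Ω)
    (hx : x ∈ frontier Ω) {v : E} (hv : ∃ᶠ t : ℝ in 𝓝[>] 0, x + t • v ∈ Ω) :
    inner ℝ (gradient ρ x) v ≤ 0 := by
  by_contra! hv2
  have h1 := hasDerivAt_comp_line h.1 x v 0
  simp only [zero_smul, add_zero] at h1
  have h2 := (hasDerivAt_iff_tendsto_slope.1 h1).eventually (lt_mem_nhds hv2)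
  have h3 : ∀ᶠ t : ℝ in 𝓝[>] 0, 0 < slope (fun t : ℝ => ρ (x + t • v)) 0 t :=
    h2.filter_mono (nhdsWithin_mono _ fun t ht => ne_of_gt ht)
  obtain ⟨t, hta, ht, ht2, ht3⟩ := (hv.and_eventually (h3.and
    (((tendsto_line x v).eventually h.2.2).and self_mem_nhdsWithin))).exists
  rw [ht2] at hta
  rw [slope_def_field] at ht
  simp only [zero_smul, add_zero, sub_zero, h.eq_zero hΩ hx] at ht
  have ht3 : 0 < t := ht3
  exact absurd ht (not_lt.2 (div_nonpos_of_nonpos_of_nonneg hta.le ht3.le))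

theorem norm_inv_norm_smul {v : E} (hv : v ≠ 0) : ‖(‖v‖⁻¹ • v)‖ = 1 := by
  rw [norm_smul, norm_inv, norm_norm, inv_mul_cancel₀ (norm_ne_zero_iff.2 hv)]

/-- Two unit vectors are equal as soon as every direction that is obtuse to the first one is
not acute to the second one. -/
theorem eq_of_inner_neg_imp {a b : E} (ha : ‖a‖ = 1) (hb : ‖b‖ = 1)
    (h : ∀ v : E, inner ℝ a v < 0 → inner ℝ b v ≤ 0) : a = b := by
  by_contra hab
  have h1 : inner ℝ a b < 1 := (inner_lt_one_iff_real_of_norm_eq_one ha hb).2 hab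
  have h2 := h (b - a) (by rw [inner_sub_right, real_inner_self_eq_norm_sq, ha]; linarith)
  rw [inner_sub_right, real_inner_self_eq_norm_sq, hb, real_inner_comm] at h2
  linarith

theorem IsOutwardUnitNormal.norm_eq_one {ν : E} (h : IsOutwardUnitNormal Ω x ν) : ‖ν‖ = 1 := by
  obtain ⟨ρ, hρ, rfl⟩ := h
  exact norm_inv_norm_smul hρ.2.1

theorem IsOutwardUnitNormal.eventually_mem {ν : E} (h : IsOutwardUnitNormal Ω x ν) (hΩ : IsOpen Ω)
    (hx : x ∈ frontier Ω) {v : E} (hv : inner ℝ ν v < 0) :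
    ∀ᶠ t : ℝ in 𝓝[>] 0, x + t • v ∈ Ω := by
  obtain ⟨ρ, hρ, rfl⟩ := h
  refine hρ.eventually_mem hΩ hx ?_
  rw [real_inner_smul_left] at hv
  have : 0 < ‖gradient ρ x‖⁻¹ := inv_pos.2 (norm_pos_iff.2 hρ.2.1)
  by_contra! h2
  exact absurd hv (not_lt.2 (by positivity))

theorem IsOutwardUnitNormal.inner_nonpos {ν : E} (h : IsOutwardUnitNormal Ω x ν) (hΩ : IsOpen Ω)
    (hx : x ∈ frontier Ω) {v : E} (hv : ∃ᶠ t : ℝ in 𝓝[>] 0, x + t • v ∈ Ω) :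
    inner ℝ ν v ≤ 0 := by
  obtain ⟨ρ, hρ, rfl⟩ := h
  rw [real_inner_smul_left]
  exact mul_nonpos_of_nonneg_of_nonpos (by positivity) (hρ.inner_nonpos hΩ hx hv)

theorem IsOutwardUnitNormal.unique {ν ν' : E} (h : IsOutwardUnitNormal Ω x ν)
    (h' : IsOutwardUnitNormal Ω x ν') (hΩ : IsOpen Ω) (hx : x ∈ frontier Ω) : ν = ν' :=
  eq_of_inner_neg_imp h.norm_eq_one h'.norm_eq_one fun _ hv =>
    h'.inner_nonpos hΩ hx (h.eventually_mem hΩ hx hv).frequently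

theorem IsLocalDefiningFunction.outwardNormal_eq (h : IsLocalDefiningFunction Ω x ρ)
    (hΩ : IsBoundedSmoothDomain Ω) (hx : x ∈ frontier Ω) :
    outwardNormal Ω x = ‖gradient ρ x‖⁻¹ • gradient ρ x :=
  (hΩ.isOutwardUnitNormal hx).unique ⟨ρ, h, rfl⟩ hΩ.isOpen hx

theorem IsBoundedSmoothDomain.norm_outwardNormal (hΩ : IsBoundedSmoothDomain Ω)
    (hx : x ∈ frontier Ω) : ‖outwardNormal Ω x‖ = 1 :=
  (hΩ.isOutwardUnitNormal hx).norm_eq_one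

theorem IsBoundedSmoothDomain.isCompact_frontier (hΩ : IsBoundedSmoothDomain Ω) :
    IsCompact (frontier Ω) :=
  Metric.isCompact_of_isClosed_isBounded isClosed_frontier
    (hΩ.isBounded.closure.subset frontier_subset_closure)

/-- Near a boundary point `n` is the normalized gradient of one fixed ρ, hence C¹; compactness makes
the Lipschitz constant global. -/
theorem IsBoundedSmoothDomain.exists_lipschitzOnWith_outwardNormal
    (hΩ : IsBoundedSmoothDomain Ω) :
    ∃ L, LipschitzOnWith L (outwardNormal Ω) (frontier Ω) := by
  refine LocallyLipschitzOn.exists_lipschitzOnWith_of_compact hΩ.isCompact_frontier ?_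
  intro x hx
  obtain ⟨ρ, hρ⟩ := hΩ.smooth x hx
  have h1 : ContDiffAt ℝ 1 (fun y => ‖gradient ρ y‖⁻¹ • gradient ρ y) x := by
    have h2 : ContDiffAt ℝ 1 (gradient ρ) x :=
      ((ContDiff.gradient hρ.1).of_le (by norm_cast)).contDiffAt
    exact ((h2.norm ℝ hρ.2.1).inv (norm_ne_zero_iff.2 hρ.2.1)).smul h2
  obtain ⟨K, t, ht, hK⟩ := h1.exists_lipschitzOnWith
  refine ⟨K, t ∩ {y | IsLocalDefiningFunction Ω y ρ} ∩ frontier Ω, ?_, ?_⟩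
  · exact inter_mem (nhdsWithin_le_nhds (inter_mem ht hρ.eventually)) self_mem_nhdsWithin
  · intro y hy z hz
    rw [hy.1.2.outwardNormal_eq hΩ hy.2, hz.1.2.outwardNormal_eq hΩ hz.2]
    exact hK hy.1.1 hz.1.1

/-- As ρ vanishes at y and z, its Taylor remainder is -∇ρ(y)·(z - y), and the Lipschitz bound on ∇ρ
makes it quadratic. This curvature bound yields both the tube radius and the order h² of the skin.
-/
theorem IsBoundedSmoothDomain.local_abs_inner_le (hΩ : IsBoundedSmoothDomain Ω)
    (hx : x ∈ frontier Ω) : ∃ K : ℝ, ∃ U ∈ 𝓝 x, ∀ y ∈ U ∩ frontier Ω, ∀ z ∈ U ∩ frontier Ω,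
      |inner ℝ (z - y) (outwardNormal Ω y)| ≤ K * ‖z - y‖ ^ 2 := by
  obtain ⟨ρ, hρ⟩ := hΩ.smooth x hx
  have hc : ContDiff ℝ ∞ (gradient ρ) := ContDiff.gradient hρ.1
  obtain ⟨K, t, ht, hK⟩ :=
    ((hc.of_le (m := 1) (by norm_cast)).contDiffAt (x := x)).exists_lipschitzOnWith
  set a := ‖gradient ρ x‖ / 2 with ha
  have ha0 : 0 < a := by have := norm_pos_iff.2 hρ.2.1; positivity
  have h1 : ∀ᶠ y in 𝓝 x, a < ‖gradient ρ y‖ :=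
    hc.continuous.norm.continuousAt.eventually (lt_mem_nhds (by linarith))
  -- A ball, so that the segment from y to z stays where ∇ρ is Lipschitz.
  obtain ⟨ε, hε, hball⟩ := Metric.mem_nhds_iff.1 (inter_mem ht (inter_mem h1 hρ.eventually))
  refine ⟨K / a, Metric.ball x ε, Metric.ball_mem_nhds x hε, ?_⟩
  rintro y ⟨hy, hyf⟩ z ⟨hz, hzf⟩
  have hyb := hball hy
  have hzb := hball hz
  have hy0 := hyb.2.2.eq_zero hΩ.isOpen hyf
  have hz0 := hzb.2.2.eq_zero hΩ.isOpen hzf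
  have h2 : ‖(ρ z - innerSL ℝ (gradient ρ y) z) - (ρ y - innerSL ℝ (gradient ρ y) y)‖ ≤
      (K * ‖z - y‖) * ‖z - y‖ := by
    refine Convex.norm_image_sub_le_of_norm_hasFDerivWithin_le (s := segment ℝ y z)
      (f := fun w => ρ w - innerSL ℝ (gradient ρ y) w)
      (f' := fun w => innerSL ℝ (gradient ρ w) - innerSL ℝ (gradient ρ y)) ?_ ?_
      (convex_segment y z) (left_mem_segment ℝ y z) (right_mem_segment ℝ y z)
    · intro w _
      exact ((ContDiff.hasFDerivAt_inner_gradient hρ.1 w).sub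
        (innerSL ℝ (gradient ρ y)).hasFDerivAt).hasFDerivWithinAt
    · intro w hw
      rw [← map_sub, innerSL_apply_norm]
      have hwb := hball ((convex_ball x ε).segment_subset hy hz hw)
      have h3 := hK.dist_le_mul w hwb.1 y hyb.1
      rw [dist_eq_norm] at h3
      refine h3.trans (mul_le_mul_of_nonneg_left ?_ K.coe_nonneg)
      rw [dist_eq_norm]
      obtain ⟨θ, hθ, rfl⟩ := segment_eq_image' ℝ y z ▸ hw
      rw [add_sub_cancel_left, norm_smul, Real.norm_of_nonneg hθ.1]
      exact mul_le_of_le_one_left (norm_nonneg _) hθ.2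
  rw [hy0, hz0] at h2
  have h4 : |inner ℝ (z - y) (gradient ρ y)| ≤ K * ‖z - y‖ ^ 2 := by
    have : (0 - innerSL ℝ (gradient ρ y) z) - (0 - innerSL ℝ (gradient ρ y) y) =
        -inner ℝ (z - y) (gradient ρ y) := by
      rw [real_inner_comm, inner_sub_right, innerSL_apply_apply, innerSL_apply_apply]; ring
    rw [this, norm_neg, Real.norm_eq_abs] at h2
    linarith
  rw [hyb.2.2.outwardNormal_eq hΩ hyf, inner_smul_right, abs_mul, abs_inv, abs_norm]
  have h5 : ‖gradient ρ y‖⁻¹ ≤ a⁻¹ := inv_anti₀ ha0 hyb.2.1.le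
  calc _ ≤ a⁻¹ * (K * ‖z - y‖ ^ 2) := by gcongr
    _ = _ := by ring

/-- Compactness of Γ × Γ: the local bound serves near the diagonal; elsewhere |z - y| is bounded
below and Cauchy-Schwarz suffices. -/
theorem IsBoundedSmoothDomain.exists_abs_inner_le (hΩ : IsBoundedSmoothDomain Ω) :
    ∃ K : ℝ, 0 < K ∧ ∀ y ∈ frontier Ω, ∀ z ∈ frontier Ω,
      |inner ℝ (z - y) (outwardNormal Ω y)| ≤ K * ‖z - y‖ ^ 2 := by
  have key : ∃ K : ℝ, ∀ q ∈ frontier Ω ×ˢ frontier Ω, q ∈ frontier Ω ×ˢ frontier Ω →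
      |inner ℝ (q.2 - q.1) (outwardNormal Ω q.1)| ≤ K * ‖q.2 - q.1‖ ^ 2 := by
    refine (hΩ.isCompact_frontier.prod hΩ.isCompact_frontier).induction_on
      (p := fun S => ∃ K : ℝ, ∀ q ∈ S, q ∈ frontier Ω ×ˢ frontier Ω →
      |inner ℝ (q.2 - q.1) (outwardNormal Ω q.1)| ≤ K * ‖q.2 - q.1‖ ^ 2) ⟨0, by simp⟩ ?_ ?_ ?_
    · rintro s t hst ⟨K, hK⟩
      exact ⟨K, fun q hq => hK q (hst hq)⟩
    · rintro s t ⟨K, hK⟩ ⟨K', hK'⟩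
      refine ⟨max K K', ?_⟩
      rintro q (hq | hq) hq2
      · exact (hK q hq hq2).trans (by gcongr; exact le_max_left _ _)
      · exact (hK' q hq hq2).trans (by gcongr; exact le_max_right _ _)
    · rintro ⟨y, z⟩ ⟨hy, hz⟩
      by_cases hyz : y = z
      · subst hyz
        obtain ⟨K, U, hU, h⟩ := hΩ.local_abs_inner_le hy
        refine ⟨U ×ˢ U, nhdsWithin_le_nhds (prod_mem_nhds hU hU), K, ?_⟩
        rintro q ⟨hq1, hq2⟩ ⟨hq3, hq4⟩
        exact h _ ⟨hq1, hq3⟩ _ ⟨hq2, hq4⟩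
      · set d := ‖z - y‖ / 2 with hd
        have hd0 : 0 < d := by have := norm_pos_iff.2 (sub_ne_zero.2 (Ne.symm hyz)); positivity
        have hcont : Continuous fun q : E × E => ‖q.2 - q.1‖ := by fun_prop
        have hev : ∀ᶠ q : E × E in 𝓝 (y, z), d < ‖q.2 - q.1‖ :=
          hcont.continuousAt.eventually (lt_mem_nhds (by simp only; linarith))
        refine ⟨_, nhdsWithin_le_nhds hev, d⁻¹, ?_⟩
        rintro q hq ⟨hq3, hq4⟩
        have hq : d < ‖q.2 - q.1‖ := hq
        have h1 := abs_real_inner_le_norm (q.2 - q.1) (outwardNormal Ω q.1)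
        rw [hΩ.norm_outwardNormal hq3, mul_one] at h1
        refine h1.trans ?_
        rw [inv_mul_eq_div, le_div_iff₀ hd0, sq]
        gcongr
  obtain ⟨K, hK⟩ := key
  refine ⟨max K 1, by positivity, fun y hy z hz => (hK (y, z) ⟨hy, hz⟩ ⟨hy, hz⟩).trans ?_⟩
  gcongr
  exact le_max_left _ _

/-! ### The tubular neighbourhood -/

theorem eq_of_inner_pos_imp {a b : E} (ha : ‖a‖ = 1) (hb : ‖b‖ = 1)
    (h : ∀ v : E, 0 < inner ℝ a v → inner ℝ b v ≤ 0) : b = -a := by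
  refine (eq_of_inner_neg_imp (by rwa [norm_neg]) hb fun v hv => h v ?_).symm
  rw [inner_neg_left] at hv
  linarith

/-- The squared distance to z changes by -2t⟨z - x, v⟩ + t²‖v‖², negative for small t. -/
theorem eventually_mem_ball {z : E} (h : 0 < inner ℝ (z - x) v) :
    ∀ᶠ t : ℝ in 𝓝[>] 0, x + t • v ∈ Metric.ball z (dist z x) := by
  have h1 : Tendsto (fun t : ℝ => t * ‖v‖ ^ 2) (𝓝[>] 0) (𝓝 0) := by
    have h : Continuous (fun t : ℝ => t * ‖v‖ ^ 2) := by fun_prop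
    simpa using (h.tendsto 0).mono_left nhdsWithin_le_nhds
  filter_upwards [h1.eventually (gt_mem_nhds (by linarith : 0 < 2 * inner ℝ (z - x) v)),
    self_mem_nhdsWithin] with t ht ht0
  have ht0 : 0 < t := ht0
  rw [Metric.mem_ball, dist_comm, dist_eq_norm, dist_eq_norm]
  refine lt_of_pow_lt_pow_left₀ 2 (norm_nonneg _) ?_
  have h2 : z - (x + t • v) = (z - x) - t • v := by abel
  rw [h2, norm_sub_sq_real, inner_smul_right, norm_smul, Real.norm_of_nonneg ht0.le]
  nlinarith [mul_pos ht0 (sub_pos.2 ht)]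

/-- A connected set that misses ∂Ω cannot meet both Ω and the exterior. -/
theorem ball_subset_or_disjoint {z : E} {r : ℝ} (h : Disjoint (Metric.ball z r) (frontier Ω))
    (hΩ : IsOpen Ω) : (z ∈ Ω → Metric.ball z r ⊆ Ω) ∧
      (z ∉ Ω → Disjoint (Metric.ball z r) Ω) := by
  rcases le_or_gt r 0 with hr | hr
  · simp [Metric.ball_eq_empty.2 hr]
  have hz : z ∈ Metric.ball z r := Metric.mem_ball_self hr
  have hcov : Metric.ball z r ⊆ Ω ∪ (closure Ω)ᶜ := by
    intro y hy
    by_contra hy2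
    simp only [Set.mem_union, Set.mem_compl_iff, not_or, not_not] at hy2
    exact Set.disjoint_left.1 h hy (hΩ.frontier_eq ▸ ⟨hy2.2, hy2.1⟩)
  have hconn : IsPreconnected (Metric.ball z r) := (convex_ball z r).isPreconnected
  have hdisj : Disjoint Ω (closure Ω)ᶜ :=
    Set.disjoint_left.2 fun y hy hy2 => hy2 (subset_closure hy)
  constructor
  · intro hzΩ
    exact hconn.subset_left_of_subset_union hΩ isClosed_closure.isOpen_compl hdisj hcov
      ⟨z, hz, hzΩ⟩
  · intro hzΩ
    have := hconn.subset_right_of_subset_union hΩ isClosed_closure.isOpen_compl hdisj hcov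
      ⟨z, hz, (hcov hz).resolve_left hzΩ⟩
    exact (hdisj.symm).mono_left this

open Classical in
/-- The foot of the perpendicular from `z` to `∂Ω`. -/
theorem IsBoundedSmoothDomain.exists_eq_add_smul_outwardNormal (hΩ : IsBoundedSmoothDomain Ω)
    (hne : (frontier Ω).Nonempty) (z : E) :
    ∃ x ∈ frontier Ω, z = x + (if z ∈ Ω then -Metric.infDist z (frontier Ω) else
      Metric.infDist z (frontier Ω)) • outwardNormal Ω x := by
  obtain ⟨x, hx, hxr⟩ := hΩ.isCompact_frontier.exists_infDist_eq_dist hne z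
  refine ⟨x, hx, ?_⟩
  rw [hxr]
  rcases eq_or_ne z x with rfl | hzx
  · simp
  have hd : 0 < dist z x := dist_pos.2 hzx
  -- The open ball about z through its nearest boundary point lies on one side of Γ. Directions
  -- pointing into it therefore all enter Ω or all avoid it, which forces z - x to be a multiple of
  -- the normal.
  have hdisj : Disjoint (Metric.ball z (dist z x)) (frontier Ω) := by
    refine Set.disjoint_left.2 fun y hy hy2 => ?_
    have h1 := Metric.infDist_le_dist_of_mem (x := z) hy2
    rw [hxr] at h1
    rw [Metric.mem_ball, dist_comm] at hy
    linarith
  obtain ⟨hin, hout⟩ := ball_subset_or_disjoint hdisj hΩ.isOpen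
  have hn := hΩ.isOutwardUnitNormal hx
  have hw : ‖((dist z x)⁻¹ • (z - x))‖ = 1 := by
    rw [dist_eq_norm]; exact norm_inv_norm_smul (sub_ne_zero.2 hzx)
  have hpos : ∀ v : E, 0 < inner ℝ ((dist z x)⁻¹ • (z - x)) v → 0 < inner ℝ (z - x) v := by
    intro v hv
    rw [real_inner_smul_left] at hv
    exact (mul_pos_iff_of_pos_left (inv_pos.2 hd)).1 hv
  have hz : z = x + dist z x • ((dist z x)⁻¹ • (z - x)) := by
    rw [smul_inv_smul₀ hd.ne']; abel
  split_ifs with hzΩ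
  · have h1 : outwardNormal Ω x = -((dist z x)⁻¹ • (z - x)) := by
      refine eq_of_inner_pos_imp hw hn.norm_eq_one fun v hv => ?_
      refine hn.inner_nonpos hΩ.isOpen hx ?_
      exact ((eventually_mem_ball (hpos v hv)).mono fun t ht => hin hzΩ ht).frequently
    rw [h1, neg_smul_neg]
    exact hz
  · have h1 : (dist z x)⁻¹ • (z - x) = outwardNormal Ω x := by
      have h2 : (dist z x)⁻¹ • (z - x) = - -outwardNormal Ω x := by
        refine eq_of_inner_pos_imp (by rw [norm_neg, hn.norm_eq_one]) hw fun v hv => ?_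
        rw [inner_neg_left] at hv
        by_contra! hv2
        have h3 := hn.eventually_mem hΩ.isOpen hx (v := v) (by linarith)
        obtain ⟨t, ht, ht2⟩ := (h3.and (eventually_mem_ball (hpos v hv2))).exists
        exact Set.disjoint_left.1 (hout hzΩ) ht2 ht
      rwa [neg_neg] at h2
    rw [← h1]
    exact hz

/-- Quantitative tubular coordinates: `n` and `π` on a tube of radius `R`. -/
structure IsTubularData (Ω : Set (EuclideanSpace ℝ (Fin N))) (R K : ℝ) (L : NNReal)
    (m : EuclideanSpace ℝ (Fin N) → EuclideanSpace ℝ (Fin N)) : Prop where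
  pos : 0 < R
  K_pos : 0 < K
  lipschitz : LipschitzWith L m
  abs_inner_le : ∀ y ∈ frontier Ω, ∀ z ∈ frontier Ω,
      |inner ℝ (z - y) (outwardNormal Ω y)| ≤ K * ‖z - y‖ ^ 2
  norm_eq_one : ∀ x ∈ frontier Ω, ‖outwardNormal Ω x‖ = 1
  field_eq : ∀ x ∈ frontier Ω, ∀ t, |t| ≤ R → m (x + t • outwardNormal Ω x) = outwardNormal Ω x
  infDist_eq : ∀ x ∈ frontier Ω, ∀ t, |t| ≤ R →
    Metric.infDist (x + t • outwardNormal Ω x) (frontier Ω) = |t|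
  mem_iff : ∀ x ∈ frontier Ω, ∀ t, |t| ≤ R → (x + t • outwardNormal Ω x ∈ Ω ↔ t < 0)
  exists_rep : ∀ z r, 0 < r → r ≤ R → z ∈ tube Ω r → ∃ x ∈ frontier Ω, ∃ t, |t| ≤ r ∧
    z = x + t • outwardNormal Ω x
  isTubularRadius : ∀ r, 0 < r → r ≤ R → IsTubularRadius Ω r
  outwardNormal_proj : ∀ r, 0 < r → r ≤ R → ∀ z ∈ tube Ω r, outwardNormal Ω (proj Ω r z) = m z

theorem mem_tube_iff (hne : (frontier Ω).Nonempty) {r : ℝ} (hr : 0 ≤ r) (z : E) :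
    z ∈ tube Ω r ↔ Metric.infDist z (frontier Ω) ≤ r := by
  rw [tube, Metric.mem_cthickening_iff, Metric.infDist,
    ENNReal.le_ofReal_iff_toReal_le (Metric.infEDist_ne_top hne) hr]

/-- Pair the difference of the two points with x - y: each curvature term costs at most a quarter of
|x - y|². This gives injectivity of the tubular coordinates and a Lipschitz bound for π. -/
theorem dist_le_of_abs_inner_le {K R : ℝ} {n : E → E} {S : Set E} (hR : 0 < R) (hKR : 4 * R * K ≤ 1)
    (hK : ∀ y ∈ S, ∀ z ∈ S, |inner ℝ (z - y) (n y)| ≤ K * ‖z - y‖ ^ 2)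
    {x y : E} (hx : x ∈ S) (hy : y ∈ S) {t s : ℝ} (ht : |t| ≤ R) (hs : |s| ≤ R) :
    dist x y ≤ 2 * dist (x + t • n x) (y + s • n y) := by
  have h1 := hK x hx y hy
  have h2 := hK y hy x hx
  have h3 : t * inner ℝ (y - x) (n x) ≤ R * (K * ‖y - x‖ ^ 2) := by
    refine (le_abs_self _).trans ?_
    rw [abs_mul]; gcongr
  have h4 : s * inner ℝ (x - y) (n y) ≤ R * (K * ‖x - y‖ ^ 2) := by
    refine (le_abs_self _).trans ?_
    rw [abs_mul]; gcongr
  have h5 : inner ℝ (x - y) ((x + t • n x) - (y + s • n y)) =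
      ‖x - y‖ ^ 2 - t * inner ℝ (y - x) (n x) - s * inner ℝ (x - y) (n y) := by
    have : (x + t • n x) - (y + s • n y) = (x - y) + t • n x - s • n y := by abel
    rw [this, inner_sub_right, inner_add_right, inner_smul_right, inner_smul_right,
      real_inner_self_eq_norm_sq, ← neg_sub x y, inner_neg_left]
    ring
  have h6 := real_inner_le_norm (x - y) ((x + t • n x) - (y + s • n y))
  rw [h5] at h6
  rw [norm_sub_rev y x] at h3
  rw [dist_eq_norm, dist_eq_norm]
  set a := ‖x - y‖
  set b := ‖(x + t • n x) - (y + s • n y)‖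
  have h7 : a ^ 2 ≤ 2 * (a * b) := by nlinarith [sq_nonneg a]
  rcases (norm_nonneg (x - y)).eq_or_lt with h | h
  · change 0 = a at h
    rw [← h]
    positivity
  · change 0 < a at h
    nlinarith

theorem IsBoundedSmoothDomain.frontier_nonempty (hN : 1 ≤ N) (hΩ : IsBoundedSmoothDomain Ω) :
    (frontier Ω).Nonempty := by
  have : Nonempty (Fin N) := ⟨⟨0, hN⟩⟩
  refine nonempty_frontier_iff.2 ⟨hΩ.isConnected.nonempty, ?_⟩
  rintro rfl
  exact NormedSpace.unbounded_univ ℝ E hΩ.isBounded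

theorem IsBoundedSmoothDomain.exists_isTubularData (hN : 1 ≤ N) (hΩ : IsBoundedSmoothDomain Ω) :
    ∃ R K L m, IsTubularData Ω R K L m := by
  have hne := hΩ.frontier_nonempty hN
  obtain ⟨K, hK0, hK⟩ := hΩ.exists_abs_inner_le
  obtain ⟨L, hL⟩ := hΩ.exists_lipschitzOnWith_outwardNormal
  set R := 1 / (4 * K) with hRdef
  have hR : 0 < R := by positivity
  have hKR : 4 * R * K ≤ 1 := by rw [hRdef]; field_simp; rfl
  have hdist : ∀ x ∈ frontier Ω, ∀ y ∈ frontier Ω, ∀ t s : ℝ, |t| ≤ R → |s| ≤ R →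
      dist x y ≤ 2 * dist (x + t • outwardNormal Ω x) (y + s • outwardNormal Ω y) :=
    fun x hx y hy t s ht hs => dist_le_of_abs_inner_le hR hKR hK hx hy ht hs
  have hn1 : ∀ x ∈ frontier Ω, ‖outwardNormal Ω x‖ = 1 := fun x hx => hΩ.norm_outwardNormal hx
  have huniq : ∀ x ∈ frontier Ω, ∀ y ∈ frontier Ω, ∀ t s : ℝ, |t| ≤ R → |s| ≤ R →
      x + t • outwardNormal Ω x = y + s • outwardNormal Ω y → x = y ∧ t = s := by
    intro x hx y hy t s ht hs h
    have h1 := hdist x hx y hy t s ht hs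
    rw [h, dist_self, mul_zero] at h1
    obtain rfl := dist_le_zero.1 h1
    refine ⟨rfl, smul_left_injective ℝ (norm_ne_zero_iff.1 (by rw [hn1 x hx]; simp))
      (add_left_cancel h)⟩
  have hbound : ∀ x ∈ frontier Ω, ∀ t : ℝ,
      Metric.infDist (x + t • outwardNormal Ω x) (frontier Ω) ≤ |t| := by
    intro x hx t
    refine (Metric.infDist_le_dist_of_mem hx).trans ?_
    rw [dist_eq_norm, add_sub_cancel_left, norm_smul, hn1 x hx, mul_one, Real.norm_eq_abs]
  classical
  -- The nearest point provides a second normal representation, with the signed distance as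
  -- coordinate; uniqueness identifies it with t.
  have hfoot : ∀ x ∈ frontier Ω, ∀ t : ℝ, |t| ≤ R →
      (if x + t • outwardNormal Ω x ∈ Ω then
        -Metric.infDist (x + t • outwardNormal Ω x) (frontier Ω) else
        Metric.infDist (x + t • outwardNormal Ω x) (frontier Ω)) = t := by
    intro x hx t ht
    obtain ⟨y, hy, hxy⟩ := hΩ.exists_eq_add_smul_outwardNormal hne (x + t • outwardNormal Ω x)
    refine (huniq x hx y hy t _ ht ?_ hxy).2.symm
    refine le_trans ?_ ((hbound x hx t).trans ht)
    split_ifs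
    · rw [abs_neg, abs_of_nonneg Metric.infDist_nonneg]
    · rw [abs_of_nonneg Metric.infDist_nonneg]
  have hinf : ∀ x ∈ frontier Ω, ∀ t : ℝ, |t| ≤ R →
      Metric.infDist (x + t • outwardNormal Ω x) (frontier Ω) = |t| := by
    intro x hx t ht
    conv_rhs => rw [← hfoot x hx t ht]
    split_ifs
    · rw [abs_neg, abs_of_nonneg Metric.infDist_nonneg]
    · rw [abs_of_nonneg Metric.infDist_nonneg]
  have hmem : ∀ x ∈ frontier Ω, ∀ t : ℝ, |t| ≤ R → (x + t • outwardNormal Ω x ∈ Ω ↔ t < 0) := by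
    intro x hx t ht
    have h1 := hfoot x hx t ht
    split_ifs at h1 with h2
    · have h4 : t ≠ 0 := by
        rintro rfl
        rw [zero_smul, add_zero] at h2
        exact notMem_of_mem_frontier hΩ.isOpen hx h2
      have h3 : t ≤ 0 := by rw [← h1]; simpa using Metric.infDist_nonneg
      exact ⟨fun _ => lt_of_le_of_ne h3 h4, fun _ => h2⟩
    · have h3 : 0 ≤ t := by rw [← h1]; exact Metric.infDist_nonneg
      exact ⟨fun h => absurd h h2, fun h => absurd h (not_lt.2 h3)⟩
  have hrep : ∀ z r, 0 < r → r ≤ R → z ∈ tube Ω r → ∃ x ∈ frontier Ω, ∃ t, |t| ≤ r ∧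
      z = x + t • outwardNormal Ω x := by
    intro z r hr0 hr hz
    obtain ⟨x, hx, hzx⟩ := hΩ.exists_eq_add_smul_outwardNormal hne z
    refine ⟨x, hx, _, ?_, hzx⟩
    have h1 : Metric.infDist z (frontier Ω) ≤ r := (mem_tube_iff hne hr0.le z).1 hz
    split_ifs
    · rwa [abs_neg, abs_of_nonneg Metric.infDist_nonneg]
    · rwa [abs_of_nonneg Metric.infDist_nonneg]
  have hrad : ∀ r, 0 < r → r ≤ R → IsTubularRadius Ω r := by
    intro r hr0 hr z hz
    obtain ⟨x, hx, t, ht, rfl⟩ := hrep z r hr0 hr hz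
    refine ⟨(x, t), ⟨hx, abs_le.1 ht, rfl⟩, ?_⟩
    rintro ⟨y, s⟩ ⟨hy, hs, h⟩
    obtain ⟨rfl, rfl⟩ := huniq x hx y hy t s (ht.trans hr) ((abs_le.2 hs).trans hr) h
    rfl
  have htube : ∀ x ∈ frontier Ω, ∀ r, 0 < r → ∀ t, |t| ≤ r →
      x + t • outwardNormal Ω x ∈ tube Ω r := fun x hx r hr t ht =>
    (mem_tube_iff hne hr.le _).2 ((hbound x hx t).trans ht)
  have hproj : ∀ x ∈ frontier Ω, ∀ r, 0 < r → r ≤ R → ∀ t, |t| ≤ r →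
      proj Ω r (x + t • outwardNormal Ω x) = x := by
    intro x hx r hr0 hr t ht
    obtain ⟨s, hy, hs, h⟩ := (hrad r hr0 hr).proj_spec (htube x hx r hr0 t ht)
    exact (huniq x hx _ hy t s (ht.trans hr) ((abs_le.2 hs).trans hr) h).1.symm
  have hlip : LipschitzOnWith (L * 2) (fun z => outwardNormal Ω (proj Ω R z)) (tube Ω R) := by
    refine LipschitzOnWith.of_dist_le_mul ?_
    intro z hz w hw
    obtain ⟨x, hx, t, ht, rfl⟩ := hrep z R hR le_rfl hz
    obtain ⟨y, hy, s, hs, rfl⟩ := hrep w R hR le_rfl hw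
    simp only [hproj x hx R hR le_rfl t ht, hproj y hy R hR le_rfl s hs]
    refine (hL.dist_le_mul x hx y hy).trans ?_
    push_cast
    rw [mul_assoc]
    gcongr
    exact hdist x hx y hy t s ht hs
  -- Extending n ∘ π to the whole space makes continuity and measurability global; inside the tube
  -- nothing changes.
  obtain ⟨m, hmL, hm⟩ := hlip.extend_finite_dimension
  have hfield : ∀ x ∈ frontier Ω, ∀ t, |t| ≤ R →
      m (x + t • outwardNormal Ω x) = outwardNormal Ω x := by
    intro x hx t ht
    rw [← hm (htube x hx R hR t ht)]
    simp only [hproj x hx R hR le_rfl t ht]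
  refine ⟨R, K, _, m, hR, hK0, hmL, hK, hn1, hfield, hinf, hmem, hrep, hrad, ?_⟩
  intro r hr0 hr z hz
  obtain ⟨x, hx, t, ht, rfl⟩ := hrep z r hr0 hr hz
  rw [hproj x hx r hr0 hr t ht, hfield x hx t (ht.trans hr)]

end

section

/-! ### The boundary of a triangulated polyhedral domain -/

/-- The relative interior of the simplex with vertex set `s`. -/
def openSimplex (s : Finset (EuclideanSpace ℝ (Fin N))) : Set (EuclideanSpace ℝ (Fin N)) :=
  {x | ∃ w : EuclideanSpace ℝ (Fin N) → ℝ, (∀ v ∈ s, 0 < w v) ∧ ∑ v ∈ s, w v = 1 ∧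
    ∑ v ∈ s, w v • v = x}

theorem openSimplex_subset_convexHull (s : Finset E) :
    openSimplex s ⊆ convexHull ℝ (s : Set E) := by
  rintro x ⟨w, hw, h1, rfl⟩
  exact Finset.mem_convexHull'.2 ⟨w, fun v hv => (hw v hv).le, h1, rfl⟩

theorem exists_mem_openSimplex {t : Finset E} {x : E} (hx : x ∈ convexHull ℝ (t : Set E)) :
    ∃ s ⊆ t, s.Nonempty ∧ x ∈ openSimplex s := by
  classical
  obtain ⟨w, hw, h1, h2⟩ := Finset.mem_convexHull'.1 hx
  have hsum : ∑ v ∈ t with w v ≠ 0, w v = 1 := by rw [Finset.sum_filter_ne_zero, h1]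
  refine ⟨t.filter fun v => w v ≠ 0, Finset.filter_subset _ _, ?_, w, ?_, hsum, ?_⟩
  · refine Finset.nonempty_of_sum_ne_zero (f := w) (by rw [hsum]; exact one_ne_zero)
  · intro v hv
    obtain ⟨hv1, hv2⟩ := Finset.mem_filter.1 hv
    exact (hw v hv1).lt_of_ne hv2.symm
  · rw [← h2]
    refine Finset.sum_subset (Finset.filter_subset _ _) fun v hv hv2 => ?_
    have : w v = 0 := by simpa [hv] using hv2
    rw [this, zero_smul]

theorem weights_unique {s : Finset E} (hs : AffineIndependent ℝ ((↑) : s → E)) {w w' : E → ℝ}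
    (h1 : ∑ v ∈ s, w v = ∑ v ∈ s, w' v) (h2 : ∑ v ∈ s, w v • v = ∑ v ∈ s, w' v • v)
    {v : E} (hv : v ∈ s) : w v = w' v := by
  have h3 := affineIndependent_iff.1 hs Finset.univ (fun v : s => w v - w' v)
    (by rw [Finset.sum_coe_sort s (fun v => w v - w' v), Finset.sum_sub_distrib, h1, sub_self])
    (by
      rw [Finset.sum_coe_sort s (fun v => (w v - w' v) • v)]
      simp_rw [sub_smul]
      rw [Finset.sum_sub_distrib, h2, sub_self]) ⟨v, hv⟩ (Finset.mem_univ _)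
  exact sub_eq_zero.1 h3

variable {K : Geometry.SimplicialComplex ℝ (EuclideanSpace ℝ (Fin N))}

/-- The two faces intersect in the hull of their common vertices; by uniqueness of barycentric
coordinates every vertex of positive weight is common. -/
theorem subset_of_mem_openSimplex {s t : Finset E} (hs : s ∈ K.faces) (ht : t ∈ K.faces) {x : E}
    (hx : x ∈ openSimplex s) (hxt : x ∈ convexHull ℝ (t : Set E)) : s ⊆ t := by
  classical
  have h1 := K.inter_subset_convexHull hs ht ⟨openSimplex_subset_convexHull s hx, hxt⟩
  rw [← Finset.coe_inter] at h1
  obtain ⟨w', hw', h1', h2'⟩ := Finset.mem_convexHull'.1 h1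
  obtain ⟨w, hw, h1, h2⟩ := hx
  intro v hv
  by_contra hvt
  have hsub : s ∩ t ⊆ s := Finset.inter_subset_left
  have key := weights_unique (K.indep hs) (w := w) (w' := fun v => if v ∈ t then w' v else 0)
    (by rw [h1, Finset.sum_ite_mem, h1'])
    (by simp_rw [ite_smul, zero_smul]; rw [h2, Finset.sum_ite_mem, h2']) hv
  simp only [hvt, if_false] at key
  exact (hw v hv).ne' key

theorem affineMap_sum_smul (l : E →ᵃ[ℝ] ℝ) {s : Finset E} {w : E → ℝ}
    (h1 : ∑ v ∈ s, w v = 1) : l (∑ v ∈ s, w v • v) = ∑ v ∈ s, w v * l v := by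
  obtain ⟨a, h⟩ : ∃ a, ∀ v, l v = l.linear v + a := ⟨l 0, fun v => congrFun l.decomp v⟩
  rw [h, map_sum]
  simp_rw [h, mul_add, map_smul, smul_eq_mul]
  rw [Finset.sum_add_distrib, ← Finset.sum_mul, h1]
  simp

/-- The affine basis formed by the vertices of a cell. -/
def cellBasis {c : Finset (EuclideanSpace ℝ (Fin N))} (hc : c ∈ cells K) :
    AffineBasis c ℝ (EuclideanSpace ℝ (Fin N)) where
  toFun := (↑)
  ind' := K.indep hc.1
  tot' := by
    refine (K.indep hc.1).affineSpan_eq_top_iff_card_eq_finrank_add_one.2 ?_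
    rw [Fintype.card_coe, hc.2, finrank_euclideanSpace_fin]

@[simp]
theorem cellBasis_apply {c : Finset E} (hc : c ∈ cells K) (v : c) : cellBasis hc v = v := rfl

theorem range_cellBasis {c : Finset E} (hc : c ∈ cells K) :
    Set.range (cellBasis hc) = (c : Set E) := by
  ext x; simp

theorem coord_vertex {c : Finset E} (hc : c ∈ cells K) (v : c) {u : E} (hu : u ∈ c) :
    (cellBasis hc).coord v u = if v = ⟨u, hu⟩ then 1 else 0 := by
  classical
  have := (cellBasis hc).coord_apply v ⟨u, hu⟩
  simpa using this

theorem mem_convexHull_iff_coord {c : Finset E} (hc : c ∈ cells K) (x : E) :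
    x ∈ convexHull ℝ (c : Set E) ↔ ∀ v, 0 ≤ (cellBasis hc).coord v x := by
  rw [← range_cellBasis hc, (cellBasis hc).convexHull_eq_nonneg_coord]; rfl

theorem continuous_coord {c : Finset E} (hc : c ∈ cells K) (v : c) :
    Continuous ((cellBasis hc).coord v) :=
  AffineMap.continuous_of_finiteDimensional _

theorem coord_pos_of_mem_openSimplex {c s : Finset E} (hc : c ∈ cells K) (hsc : s ⊆ c) {x : E}
    (hx : x ∈ openSimplex s) {v : E} (hv : v ∈ s) : 0 < (cellBasis hc).coord ⟨v, hsc hv⟩ x := by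
  obtain ⟨w, hw, h1, rfl⟩ := hx
  rw [affineMap_sum_smul _ h1, Finset.sum_eq_single v]
  · rw [coord_vertex hc _ (hsc hv), if_pos rfl, mul_one]
    exact hw v hv
  · intro u hu huv
    rw [coord_vertex hc _ (hsc hu), if_neg (by simpa using huv.symm), mul_zero]
  · exact fun h => absurd hv h

/-- An affine function that vanishes on the facet opposite to `v` is a multiple of the barycentric
coordinate of `v`. -/
theorem affineMap_eq_mul_coord {c : Finset E} (hc : c ∈ cells K) (l : E →ᵃ[ℝ] ℝ) (v : c)
    (hl : ∀ u ∈ c, u ≠ v → l u = 0) (x : E) : l x = l v * (cellBasis hc).coord v x := by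
  classical
  set b := cellBasis hc with hb
  set w : E → ℝ := fun u => if hu : u ∈ c then b.coord ⟨u, hu⟩ x else 0 with hw
  have hwu : ∀ u : c, w u = b.coord u x := fun u => by simp [hw]
  have h1 : ∑ u ∈ c, w u = 1 := by
    rw [← Finset.sum_coe_sort c w]
    simp_rw [hwu]
    exact b.sum_coord_apply_eq_one x
  have h2 : ∑ u ∈ c, w u • u = x := by
    rw [← Finset.sum_coe_sort c (fun u => w u • u)]
    simp_rw [hwu]
    exact b.linear_combination_coord_eq_self x
  conv_lhs => rw [← h2]
  rw [affineMap_sum_smul _ h1, Finset.sum_eq_single (v : E), hwu, mul_comm]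
  · intro u hu huv
    rw [hl u hu huv, mul_zero]
  · exact fun h => absurd v.2 h

theorem convexHull_subset_closure_interior {c : Finset E} (hc : c ∈ cells K) :
    convexHull ℝ (c : Set E) ⊆ closure (polyDomain K) := by
  have h1 : (interior (convexHull ℝ (c : Set E))).Nonempty := by
    rw [interior_convexHull_nonempty_iff_affineSpan_eq_top, ← range_cellBasis hc]
    exact (cellBasis hc).tot
  refine subset_closure.trans ?_
  rw [← (convex_convexHull ℝ _).closure_interior_eq_closure_of_nonempty_interior h1]
  exact closure_mono (interior_mono (Geometry.SimplicialComplex.convexHull_subset_space hc.1))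

theorem isCompact_space (hK : K.faces.Finite) : IsCompact K.space :=
  hK.isCompact_biUnion fun s _ => s.finite_toSet.isCompact_convexHull ℝ

theorem isOpen_polyDomain : IsOpen (polyDomain K) := isOpen_interior

theorem frontier_polyDomain_subset_space (hK : K.faces.Finite) :
    frontier (polyDomain K) ⊆ K.space :=
  frontier_subset_closure.trans
    (closure_minimal interior_subset (isCompact_space hK).isClosed)

theorem eventually_mem_of_mem_cell (hK : K.faces.Finite) (z : E) :
    ∀ᶠ p in 𝓝 z, ∀ c ∈ K.faces, p ∈ convexHull ℝ (c : Set E) → z ∈ convexHull ℝ (c : Set E) := by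
  refine (eventually_all_finite hK).2 fun c _ => ?_
  by_cases h : z ∈ convexHull ℝ (c : Set E)
  · exact Eventually.of_forall fun _ _ => h
  · filter_upwards [(c.finite_toSet.isClosed_convexHull ℝ).isOpen_compl.mem_nhds h] with p hp hp2
    exact absurd hp2 hp

/-- The coordinates other than that of v are positive at y and remain so nearby: next to a facet, a
cell fills one side of the hyperplane. -/
theorem eventually_mem_convexHull {c s : Finset E} {v : E} (hc : c ∈ cells K) (hv : v ∈ c)
    (hcs : ∀ u ∈ c, u ≠ v → u ∈ s) (hsc : s ⊆ c) {y : E} (hy : y ∈ openSimplex s) :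
    ∀ᶠ p in 𝓝 y, 0 ≤ (cellBasis hc).coord ⟨v, hv⟩ p → p ∈ convexHull ℝ (c : Set E) := by
  have h1 : ∀ᶠ p in 𝓝 y, ∀ u : c, (u : E) ≠ v → 0 ≤ (cellBasis hc).coord u p := by
    refine eventually_all.2 fun u => ?_
    by_cases huv : (u : E) = v
    · exact Eventually.of_forall fun _ h => absurd huv h
    · have h2 := coord_pos_of_mem_openSimplex hc hsc hy (hcs u u.2 huv)
      filter_upwards [(continuous_coord hc u).continuousAt.eventually (lt_mem_nhds h2)]
        with p hp _
      exact hp.le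
  filter_upwards [h1] with p hp hp2
  rw [mem_convexHull_iff_coord hc]
  intro u
  by_cases huv : (u : E) = v
  · have : u = ⟨v, hv⟩ := Subtype.ext huv
    rwa [this]
  · exact hp u huv

/-- If one relatively interior point of an `(N-1)`-face is interior to the triangulated region, then
all of them are. -/
theorem mem_interior_space_of_openSimplex (hfin : K.faces.Finite)
    (hpure : ∀ s ∈ K.faces, ∃ t ∈ cells K, s ⊆ t) {s : Finset E} (hs : s ∈ K.faces)
    (hcard : s.card = N) {y z : E} (hy : y ∈ openSimplex s) (hz : z ∈ openSimplex s)
    (hzi : z ∈ interior K.space) : y ∈ interior K.space := by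
  classical
  have hfacet : ∀ c ∈ cells K, s ⊆ c → ∃ v ∈ c, v ∉ s ∧ ∀ u ∈ c, u ≠ v → u ∈ s := by
    intro c hc hsc
    have h1 : (c \ s).card = 1 := by
      rw [Finset.card_sdiff_of_subset hsc, hc.2, hcard]; omega
    obtain ⟨v, hv⟩ := Finset.card_eq_one.1 h1
    have hv1 : v ∈ c \ s := by rw [hv]; exact Finset.mem_singleton_self v
    refine ⟨v, (Finset.mem_sdiff.1 hv1).1, (Finset.mem_sdiff.1 hv1).2, fun u hu huv => ?_⟩
    by_contra hus
    have : u ∈ c \ s := Finset.mem_sdiff.2 ⟨hu, hus⟩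
    rw [hv, Finset.mem_singleton] at this
    exact huv this
  have hzero : ∀ (c) (hc : c ∈ cells K) (hsc : s ⊆ c) (v : E) (hv : v ∈ c), v ∉ s →
      ∀ u ∈ s, (cellBasis hc).coord ⟨v, hv⟩ u = 0 := by
    intro c hc hsc v hv hvs u hu
    rw [coord_vertex hc _ (hsc hu), if_neg]
    intro h
    exact hvs (by rw [Subtype.mk.inj h]; exact hu)
  obtain ⟨c, hc, hsc⟩ := hpure s hs
  obtain ⟨v, hv, hvs, hcs⟩ := hfacet c hc hsc
  set l := (cellBasis hc).coord ⟨v, hv⟩ with hl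
  have hlz : l z = 0 := by
    obtain ⟨w, -, h1, rfl⟩ := hz
    rw [affineMap_sum_smul _ h1]
    exact Finset.sum_eq_zero fun u hu => by rw [hzero c hc hsc v hv hvs u hu, mul_zero]
  have hlv : l v = 1 := by rw [hl, coord_vertex hc _ hv, if_pos rfl]
  -- A point just beyond the facet, on the side away from `c`, lies in some cell `c'`; by local
  -- finiteness `c'` also contains z, hence s.
  obtain ⟨ε, ⟨hε1, hε2⟩, hε⟩ := (((tendsto_line z (z - v)).eventually
    ((isOpen_interior.eventually_mem hzi).and (eventually_mem_of_mem_cell hfin z))).and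
      self_mem_nhdsWithin).exists
  have hε0 : 0 < ε := hε
  set p := z + ε • (z - v) with hp
  have hlp : l p = -ε := by
    have h3 : p = AffineMap.lineMap z v (-ε) := by
      rw [AffineMap.lineMap_apply_module', hp, neg_smul, ← smul_neg, neg_sub, add_comm]
    rw [h3, AffineMap.apply_lineMap, hlz, hlv, AffineMap.lineMap_apply_module]
    simp
  obtain ⟨t, ht, hpt⟩ := Geometry.SimplicialComplex.mem_space_iff.1 (interior_subset hε1)
  obtain ⟨c', hc', htc'⟩ := hpure t ht
  have hpc' : p ∈ convexHull ℝ (c' : Set E) := convexHull_mono (Finset.coe_subset.2 htc') hpt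
  have hsc' : s ⊆ c' := subset_of_mem_openSimplex hs hc'.1 hz (hε2 c' hc'.1 hpc')
  obtain ⟨v', hv', hvs', hcs'⟩ := hfacet c' hc' hsc'
  set l' := (cellBasis hc').coord ⟨v', hv'⟩ with hl'
  -- Both coordinates vanish on s, so they are proportional. The factor turns out nonpositive, so
  -- `c` and `c'` together cover both sides near y.
  have hprop : ∀ x, l' x = l' v * l x := affineMap_eq_mul_coord hc l' ⟨v, hv⟩
    fun u hu huv => hzero c' hc' hsc' v' hv' hvs' u (hcs u hu huv)
  have hneg : l' v ≤ 0 := by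
    have h3 := (mem_convexHull_iff_coord hc' p).1 hpc' ⟨v', hv'⟩
    rw [← hl', hprop, hlp] at h3
    nlinarith
  rw [mem_interior_iff_mem_nhds]
  filter_upwards [eventually_mem_convexHull hc hv hcs hsc hy,
    eventually_mem_convexHull hc' hv' hcs' hsc' hy] with q hq hq'
  rcases le_total 0 (l q) with h | h
  · exact Geometry.SimplicialComplex.convexHull_subset_space hc.1 (hq h)
  · refine Geometry.SimplicialComplex.convexHull_subset_space hc'.1 (hq' ?_)
    rw [← hl', hprop]
    exact mul_nonneg_of_nonpos_of_nonpos hneg h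

/-- The `(N-2)`-skeleton. -/
def lowSkeleton (K : Geometry.SimplicialComplex ℝ (EuclideanSpace ℝ (Fin N))) :
    Set (EuclideanSpace ℝ (Fin N)) :=
  ⋃ s ∈ {s ∈ K.faces | s.card < N}, convexHull ℝ (s : Set (EuclideanSpace ℝ (Fin N)))

/-- The carrier of y has exactly N vertices: fewer would put y in the skeleton, N + 1 in the
interior of a cell. If its hull contained an interior point z of the region, a small move from z
towards y would reach an interior point in the open face, and y would be interior too. -/
theorem exists_boundaryFace (hfin : K.faces.Finite)
    (hpure : ∀ s ∈ K.faces, ∃ t ∈ cells K, s ⊆ t) {y : E} (hy : y ∈ frontier (polyDomain K))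
    (hyS : y ∉ lowSkeleton K) : ∃ s ∈ boundaryFaces K, y ∈ convexHull ℝ (s : Set E) := by
  obtain ⟨t, ht, hyt⟩ := Geometry.SimplicialComplex.mem_space_iff.1
    (frontier_polyDomain_subset_space hfin hy)
  obtain ⟨s, hst, hsne, hys⟩ := exists_mem_openSimplex hyt
  have hs : s ∈ K.faces := K.down_closed ht hst hsne
  have hys' := openSimplex_subset_convexHull s hys
  have hyi : y ∉ interior K.space := notMem_of_mem_frontier isOpen_polyDomain hy
  have hNs : N ≤ s.card := by
    by_contra! h
    exact hyS (Set.mem_biUnion (show s ∈ {s ∈ K.faces | s.card < N} from ⟨hs, h⟩) hys')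
  have hsN : s.card = N := by
    obtain ⟨c, hc, hsc⟩ := hpure s hs
    have h1 := Finset.card_le_card hsc
    rw [hc.2] at h1
    by_contra hne
    have h2 : s ∈ cells K := ⟨hs, by omega⟩
    refine hyi (interior_mono (Geometry.SimplicialComplex.convexHull_subset_space hs) ?_)
    rw [← range_cellBasis h2, (cellBasis h2).interior_convexHull]
    exact fun v => coord_pos_of_mem_openSimplex h2 subset_rfl hys v.2
  refine ⟨s, ⟨hs, hsN, ?_⟩, hys'⟩
  intro z hz
  rw [isOpen_polyDomain.frontier_eq]
  obtain ⟨c, hc, hsc⟩ := hpure s hs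
  refine ⟨convexHull_subset_closure_interior hc (convexHull_mono (Finset.coe_subset.2 hsc) hz), ?_⟩
  intro hzi
  obtain ⟨ε, hε1, hε⟩ := (((tendsto_line z (y - z)).eventually
    (isOpen_interior.mem_nhds hzi)).and (Ioc_mem_nhdsGT (zero_lt_one' ℝ))).exists
  refine hyi (mem_interior_space_of_openSimplex hfin hpure hs hsN hys ?_ hε1)
  obtain ⟨w, hw, h1, rfl⟩ := hys
  obtain ⟨w', hw', h1', rfl⟩ := Finset.mem_convexHull'.1 hz
  refine ⟨fun v => (1 - ε) * w' v + ε * w v, ?_, ?_, ?_⟩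
  · intro v hv
    have h3 := mul_pos hε.1 (hw v hv)
    have h4 := mul_nonneg (sub_nonneg.2 hε.2) (hw' v hv)
    linarith
  · rw [Finset.sum_add_distrib, ← Finset.mul_sum, ← Finset.mul_sum, h1, h1']; ring
  · simp_rw [add_smul, mul_smul]
    rw [Finset.sum_add_distrib, ← Finset.smul_sum, ← Finset.smul_sum]
    module

/-- Each of these simplices lies in an isometric copy of a vector space of dimension below N - 1. -/
theorem euclideanHausdorffMeasure_lowSkeleton (hfin : K.faces.Finite) :
    Measure.euclideanHausdorffMeasure (N - 1) (lowSkeleton K) = 0 := by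
  refine (measure_biUnion_null_iff (hfin.subset (Set.sep_subset _ _)).countable).2 ?_
  rintro s ⟨hs, hcard⟩
  obtain ⟨v, hv⟩ := Geometry.SimplicialComplex.nonempty_of_mem_faces hs
  set V := vectorSpan ℝ (s : Set E) with hV
  have hVrank : Module.finrank ℝ V < N - 1 := by
    have h1 : Module.finrank ℝ V + 1 = s.card := by
      have : Nonempty s := ⟨⟨v, hv⟩⟩
      have := (K.indep hs).finrank_vectorSpan_add_one
      have hr : Set.range ((↑) : s → E) = (s : Set E) := by ext; simp
      rwa [hr, Fintype.card_coe] at this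
    omega
  have hiso : Isometry (fun w : V => (w : E) + v) := by
    refine Isometry.of_dist_eq fun w w' => ?_
    simp [Subtype.dist_eq]
  have hsub : convexHull ℝ (s : Set E) ⊆ Set.range (fun w : V => (w : E) + v) := by
    intro x hx
    have h1 := convexHull_subset_affineSpan (s : Set E) hx
    refine ⟨⟨x - v, ?_⟩, by simp⟩
    exact vsub_mem_vectorSpan_of_mem_affineSpan_of_mem_affineSpan h1
      (subset_affineSpan ℝ _ hv)
  have hdim : dimH (convexHull ℝ (s : Set E)) < ((N - 1 : ℕ) : NNReal) := by
    refine (dimH_mono hsub).trans_lt (hiso.lipschitz.dimH_range_le.trans_lt ?_)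
    rw [Real.dimH_univ_eq_finrank]
    exact_mod_cast hVrank
  have h0 := hausdorffMeasure_of_dimH_lt hdim
  rw [Measure.euclideanHausdorffMeasure_def, Measure.smul_apply]
  rw [NNReal.coe_natCast] at h0
  rw [h0, smul_zero]

/-! ### Distance of the boundary mesh to the smooth boundary -/

theorem IsAdmissibleMesh.diam_le {Ω : Set E} {c : ℝ} (hK : IsAdmissibleMesh Ω c K)
    {s : Finset E} (hs : s ∈ K.faces) {x y : E} (hx : x ∈ convexHull ℝ (s : Set E))
    (hy : y ∈ convexHull ℝ (s : Set E)) : dist x y ≤ meshSize K := by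
  obtain ⟨t, ht, hst⟩ := hK.pure s hs
  have hst' := convexHull_mono (𝕜 := ℝ) (Finset.coe_subset.2 hst)
  refine (Metric.dist_le_diam_of_mem ?_ (hst' hx) (hst' hy)).trans ?_
  · exact (t.finite_toSet.isCompact_convexHull ℝ).isBounded
  · refine le_csSup ?_ ⟨t, ht, rfl⟩
    exact ((hK.finite.subset fun s hs => hs.1).image _).bddAbove

theorem IsAdmissibleMesh.meshSize_pos {Ω : Set E} {c : ℝ} (hK : IsAdmissibleMesh Ω c K)
    (hN : 1 ≤ N) : 0 < meshSize K := by
  obtain ⟨x, hx⟩ := hK.isConnected.nonempty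
  obtain ⟨s, hs, -⟩ := Geometry.SimplicialComplex.mem_space_iff.1 (interior_subset hx)
  obtain ⟨t, ht, -⟩ := hK.pure s hs
  obtain ⟨a, ha, b, hb, hab⟩ := Finset.one_lt_card.1 (show 1 < t.card by rw [ht.2]; omega)
  exact (dist_pos.2 hab).trans_le (hK.diam_le ht.1 (subset_convexHull ℝ _ ha)
    (subset_convexHull ℝ _ hb))

/-- Writing the point as a convex combination of vertices v makes t the same combination of the
heights ⟨v - x, n(x)⟩, which are quadratic in |v - x|. As |t| is the distance to Γ, it is at most h,
so |v - x| ≤ 2h. -/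
theorem IsTubularData.abs_le_of_mem_boundaryFace {Ω : Set E} {R κ : ℝ} {L : NNReal} {m : E → E}
    (hT : IsTubularData Ω R κ L m) {s : Finset E} (hs : (s : Set E) ⊆ frontier Ω) {h : ℝ}
    (hdiam : ∀ y ∈ convexHull ℝ (s : Set E), ∀ v ∈ s, dist v y ≤ h)
    {x : E} {t : ℝ} (hx : x ∈ frontier Ω) (ht : |t| ≤ R)
    (hy : x + t • outwardNormal Ω x ∈ convexHull ℝ (s : Set E)) :
    |t| ≤ 4 * κ * h ^ 2 := by
  have hdiam' := hdiam _ hy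
  obtain ⟨w, hw, h1, h2⟩ := Finset.mem_convexHull'.1 hy
  have hn := hT.norm_eq_one x hx
  obtain ⟨v₀, hv₀⟩ : s.Nonempty :=
    Finset.nonempty_of_sum_ne_zero (f := w) (by rw [h1]; exact one_ne_zero)
  have hth : |t| ≤ h := by
    rw [← hT.infDist_eq x hx t ht]
    refine (Metric.infDist_le_dist_of_mem (hs hv₀)).trans ?_
    rw [dist_comm]
    exact hdiam' v₀ hv₀
  have hvx : ∀ v ∈ s, ‖v - x‖ ≤ 2 * h := by
    intro v hv
    have h3 : v - x = (v - (x + t • outwardNormal Ω x)) + t • outwardNormal Ω x := by abel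
    rw [h3]
    refine (norm_add_le _ _).trans ?_
    rw [norm_smul, hn, mul_one, Real.norm_eq_abs, ← dist_eq_norm]
    linarith [hdiam' v hv]
  have h4 : t = ∑ v ∈ s, w v * inner ℝ (v - x) (outwardNormal Ω x) := by
    have h5 : t • outwardNormal Ω x = ∑ v ∈ s, w v • (v - x) := by
      simp_rw [smul_sub]
      rw [Finset.sum_sub_distrib, h2, ← Finset.sum_smul, h1, one_smul, add_sub_cancel_left]
    have h6 : inner ℝ (t • outwardNormal Ω x) (outwardNormal Ω x) = t := by
      rw [real_inner_smul_left, real_inner_self_eq_norm_sq, hn]; ring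
    rw [← h6, h5, sum_inner]
    exact Finset.sum_congr rfl fun v _ => real_inner_smul_left _ _ _
  rw [h4]
  refine (Finset.abs_sum_le_sum_abs _ _).trans ?_
  calc ∑ v ∈ s, |w v * inner ℝ (v - x) (outwardNormal Ω x)|
      ≤ ∑ v ∈ s, w v * (4 * κ * h ^ 2) := by
        refine Finset.sum_le_sum fun v hv => ?_
        rw [abs_mul, abs_of_nonneg (hw v hv)]
        refine mul_le_mul_of_nonneg_left ?_ (hw v hv)
        refine (hT.abs_inner_le x hx v (hs hv)).trans ?_
        have := hT.K_pos
        calc κ * ‖v - x‖ ^ 2 ≤ κ * (2 * h) ^ 2 := by gcongr; exact hvx v hv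
          _ = _ := by ring
    _ = _ := by rw [← Finset.sum_mul, h1, one_mul]

end

section

/-! ### Measure estimates along the normal segments -/

theorem volume_image_le_of_lipschitzWith {f : E → E} {K : NNReal} (hf : LipschitzWith K f)
    (B : Set E) : volume (f '' B) ≤ (K : ℝ≥0∞) ^ N * volume B := by
  have h := hf.hausdorffMeasure_image_le (d := (N : ℝ)) N.cast_nonneg B
  rw [← EuclideanSpace.euclideanHausdorffMeasure_eq_volume N,
    Measure.euclideanHausdorffMeasure_def, Measure.smul_apply, Measure.smul_apply,
    ENNReal.smul_def, ENNReal.smul_def, smul_eq_mul, smul_eq_mul, mul_left_comm]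
  rw [ENNReal.rpow_natCast] at h
  gcongr

/-- Needed because the comparison principle used below concerns the unnormalized Hausdorff measure.
-/
theorem exists_hausdorffMeasure_le (d : ℕ) : ∃ b : ℝ, 0 < b ∧
    (Measure.hausdorffMeasure (d : ℝ) : Measure E) ≤
      ENNReal.ofReal b • Measure.euclideanHausdorffMeasure d := by
  set a := (volume : Measure (EuclideanSpace ℝ (Fin d))).addHaarScalarFactor
    (Measure.hausdorffMeasure (d : ℝ)) with ha
  have ha0 : 0 < a := Measure.addHaarScalarFactor_pos_of_isAddHaarMeasure _ _
  refine ⟨(a : ℝ)⁻¹, by positivity, ?_⟩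
  rw [Measure.euclideanHausdorffMeasure_def, ← ha, ENNReal.smul_def, smul_smul,
    ← NNReal.coe_inv, ENNReal.ofReal_coe_nnreal, ← ENNReal.coe_mul, inv_mul_cancel₀ ha0.ne']
  simp

/-- The hypotheses under which points are moved along the field `m` from `A`, a distance `S`. -/
structure IsNormalFlow (m : EuclideanSpace ℝ (Fin N) → EuclideanSpace ℝ (Fin N)) (L : NNReal)
    (A : Set (EuclideanSpace ℝ (Fin N))) (σ : ℝ) : Prop where
  lipschitz : LipschitzWith L m
  pos : 0 < σ
  norm_le : ∀ x ∈ A, ‖m x‖ ≤ 1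
  field_eq : ∀ x ∈ A, ∀ s ∈ Set.Icc 0 σ, m (x + s • m x) = m x

variable {m : EuclideanSpace ℝ (Fin N) → EuclideanSpace ℝ (Fin N)} {L : NNReal}
  {A : Set (EuclideanSpace ℝ (Fin N))} {σ : ℝ}

/-- The end points are ε-close and m is Lipschitz, so all starting points lie near one segment
ending at y₀. About σ/ε balls of radius comparable to ε, centred at spacing at most ε on it, cover
them. -/
theorem IsNormalFlow.volume_le (h : IsNormalFlow m L A σ) (hN : 1 ≤ N) {S : E → ℝ}
    (hS : ∀ x ∈ A, S x ∈ Set.Icc 0 σ) {ε : ℝ} (hε : 0 < ε) (hεσ : ε ≤ σ) {B : Set E}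
    (hB : ∀ x ∈ B, ∀ y ∈ B, dist x y ≤ ε) :
    volume (A ∩ {x | x + S x • m x ∈ B}) ≤
      ENNReal.ofReal (2 * (2 + σ * L) ^ N * (volume (Metric.ball (0 : E) 1)).toReal * σ *
        ε ^ (N - 1)) := by
  rcases Set.eq_empty_or_nonempty (A ∩ {x | x + S x • m x ∈ B}) with he | ⟨x₀, hx₀, hx₀B⟩
  · rw [he, measure_empty]; exact zero_le
  set y₀ := x₀ + S x₀ • m x₀ with hy₀
  have hmy₀ : ‖m y₀‖ ≤ 1 := by
    rw [hy₀, h.field_eq x₀ hx₀ _ (hS x₀ hx₀)]; exact h.norm_le x₀ hx₀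
  set r := (2 + σ * L) * ε with hr
  have hσ := h.pos
  have hr0 : 0 ≤ r := by positivity
  set n := ⌊σ / ε⌋₊ with hn
  have hcover : A ∩ {x | x + S x • m x ∈ B} ⊆
      ⋃ j ∈ Finset.range (n + 1), Metric.closedBall (y₀ - (j * ε) • m y₀) r := by
    rintro x ⟨hx, hxB⟩
    obtain ⟨hS0, hSσ⟩ := hS x hx
    set j := ⌊S x / ε⌋₊ with hj
    have hj1 : j * ε ≤ S x := by
      rw [← le_div_iff₀ hε]; exact Nat.floor_le (by positivity)
    have hj2 : S x < (j + 1) * ε := by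
      rw [← div_lt_iff₀ hε]; exact Nat.lt_floor_add_one _
    have hjn : j ≤ n := Nat.floor_mono (by gcongr)
    refine Set.mem_biUnion (by simpa using Nat.lt_succ_of_le hjn : j ∈ Finset.range (n + 1)) ?_
    rw [Metric.mem_closedBall, dist_eq_norm]
    set y := x + S x • m x with hy
    have hmy : m y = m x := h.field_eq x hx _ (hS x hx)
    have hxy : x - (y₀ - (j * ε) • m y₀) =
        (y - y₀) - S x • (m y - m y₀) - (S x - j * ε) • m y₀ := by
      rw [hmy, hy]; module
    have hyy : ‖y - y₀‖ ≤ ε := by rw [← dist_eq_norm]; exact hB y hxB y₀ hx₀B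
    have h1 : ‖m y - m y₀‖ ≤ L * ε := (h.lipschitz.norm_sub_le y y₀).trans (by gcongr)
    have h2 : ‖S x • (m y - m y₀)‖ ≤ σ * (L * ε) := by
      rw [norm_smul, Real.norm_of_nonneg hS0]; gcongr
    have h3 : ‖(S x - j * ε) • m y₀‖ ≤ ε * 1 := by
      rw [norm_smul, Real.norm_of_nonneg (by linarith)]
      have : S x - j * ε ≤ ε := by linarith
      gcongr
    rw [hxy]
    calc _ ≤ ‖y - y₀‖ + ‖S x • (m y - m y₀)‖ + ‖(S x - j * ε) • m y₀‖ :=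
          (norm_sub_le _ _).trans (by gcongr; exact norm_sub_le _ _)
      _ ≤ r := by rw [hr]; linarith
  refine (measure_mono hcover).trans ((measure_biUnion_finset_le _ _).trans ?_)
  have hω : volume (Metric.ball (0 : E) 1) ≠ ⊤ := measure_ball_lt_top.ne
  have hvol : ∀ z : E, volume (Metric.closedBall z r) =
      ENNReal.ofReal (r ^ N * (volume (Metric.ball (0 : E) 1)).toReal) := by
    intro z
    rw [Measure.addHaar_closedBall _ _ hr0, finrank_euclideanSpace_fin,
      ENNReal.ofReal_mul (by positivity), ENNReal.ofReal_toReal hω]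
  simp_rw [hvol]
  rw [Finset.sum_const, Finset.card_range, nsmul_eq_mul, ← ENNReal.ofReal_natCast,
    ← ENNReal.ofReal_mul (by positivity)]
  refine ENNReal.ofReal_le_ofReal ?_
  -- The assumption ε ≤ σ absorbs the one extra ball.
  have hnε : ((n + 1 : ℕ) : ℝ) * ε ≤ 2 * σ := by
    have : (n : ℝ) * ε ≤ σ := by
      rw [← le_div_iff₀ hε]; exact Nat.floor_le (by positivity)
    push_cast; linarith
  obtain ⟨k, rfl⟩ : ∃ k, N = k + 1 := ⟨N - 1, by omega⟩
  rw [hr, mul_pow, Nat.add_sub_cancel]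
  set W := (volume (Metric.ball (0 : EuclideanSpace ℝ (Fin (k + 1))) 1)).toReal
  calc ((n + 1 : ℕ) : ℝ) * ((2 + σ * L) ^ (k + 1) * ε ^ (k + 1) * W)
      = (2 + σ * L) ^ (k + 1) * W * ε ^ k * (((n + 1 : ℕ) : ℝ) * ε) := by ring
    _ ≤ (2 + σ * L) ^ (k + 1) * W * ε ^ k * (2 * σ) := by gcongr
    _ = _ := by ring

/-- The image of the Lebesgue measure under the motion to the end points of the normal segments is
controlled by the length of the segments times the surface measure. -/
theorem exists_map_le_euclideanHausdorffMeasure (hN : 1 ≤ N) (L : NNReal) (σ₀ : ℝ) :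
    ∃ C : ℝ, 0 < C ∧ ∀ (m : E → E) (A : Set E) (σ : ℝ) (S : E → ℝ), IsNormalFlow m L A σ →
      σ ≤ σ₀ → Measurable S → (∀ x ∈ A, S x ∈ Set.Icc 0 σ) →
      Measure.map (fun x => x + S x • m x) (volume.restrict A) ≤
        ENNReal.ofReal (C * σ) • Measure.euclideanHausdorffMeasure (N - 1) := by
  obtain ⟨b, hb, hbH⟩ := exists_hausdorffMeasure_le (N := N) (N - 1)
  set W := (volume (Metric.ball (0 : E) 1)).toReal with hW
  have hW0 : 0 < W := ENNReal.toReal_pos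
    (Metric.isOpen_ball.measure_pos volume ⟨0, Metric.mem_ball_self one_pos⟩).ne'
    measure_ball_lt_top.ne
  set C₀ := 2 * (2 + |σ₀| * L) ^ N * W with hC₀
  have hC₀p : 0 < C₀ := by positivity
  refine ⟨C₀ * b, by positivity, ?_⟩
  intro m A σ S h hσ₀ hS hSA
  have hσ := h.pos
  have hmeas : Measurable (fun x => x + S x • m x) :=
    measurable_id.add (hS.smul h.lipschitz.continuous.measurable)
  set ν := Measure.map (fun x => x + S x • m x) (volume.restrict A) with hν
  have hc : ENNReal.ofReal (C₀ * σ) ≠ 0 := by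
    rw [Ne, ENNReal.ofReal_eq_zero, not_le]; positivity
  -- Closed sets are measurable, and passing to the closure keeps the diameter.
  have hclosed : ∀ B : Set E, IsClosed B → Metric.ediam B ≤ ENNReal.ofReal (σ / 2) →
      ν B ≤ ENNReal.ofReal (C₀ * σ) * Metric.ediam B ^ (N - 1) := by
    intro B hBc hBd
    rw [hν, Measure.map_apply hmeas hBc.measurableSet,
      Measure.restrict_apply (hmeas hBc.measurableSet), Set.inter_comm]
    have hfin : Metric.ediam B ≠ ⊤ := (hBd.trans_lt ENNReal.ofReal_lt_top).ne
    set d := (Metric.ediam B).toReal with hd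
    have hdB : Metric.ediam B = ENNReal.ofReal d := (ENNReal.ofReal_toReal hfin).symm
    have hd0 : 0 ≤ d := ENNReal.toReal_nonneg
    have hdσ : d < σ := by
      have := ENNReal.toReal_mono ENNReal.ofReal_ne_top hBd
      rw [ENNReal.toReal_ofReal (by positivity)] at this
      linarith
    rw [hdB, ← ENNReal.ofReal_pow hd0, ← ENNReal.ofReal_mul (by positivity)]
    have hcont : Continuous fun ε : ℝ => ENNReal.ofReal (C₀ * σ * ε ^ (N - 1)) := by
      refine ENNReal.continuous_ofReal.comp ?_
      fun_prop
    -- The volume bound requires ε > 0 while the diameter d may vanish, so ε decreases to d.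
    refine ge_of_tendsto ((hcont.tendsto d).mono_left (nhdsWithin_le_nhds (s := Set.Ioi d))) ?_
    filter_upwards [Ioc_mem_nhdsGT hdσ] with ε hε
    have hε0 : 0 < ε := hd0.trans_lt hε.1
    refine (h.volume_le hN hSA hε0 hε.2 ?_).trans (ENNReal.ofReal_le_ofReal ?_)
    · intro x hx y hy
      refine le_trans ?_ hε.1.le
      rw [dist_edist, hd]
      exact ENNReal.toReal_mono hfin (Metric.edist_le_ediam_of_mem hx hy)
    · rw [hC₀]
      have : σ * L ≤ |σ₀| * L := by gcongr; exact hσ₀.trans (le_abs_self _)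
      gcongr
  have hle : (ENNReal.ofReal (C₀ * σ))⁻¹ • ν ≤ Measure.hausdorffMeasure ((N - 1 : ℕ) : ℝ) := by
    refine Measure.le_hausdorffMeasure _ _ (ENNReal.ofReal (σ / 2))
      (ENNReal.ofReal_pos.2 (by positivity)) fun s hs => ?_
    rw [ENNReal.rpow_natCast, Measure.smul_apply, smul_eq_mul, ← Metric.ediam_closure]
    rw [← Metric.ediam_closure] at hs
    refine (mul_le_mul_right (measure_mono subset_closure) _).trans ?_
    refine (mul_le_mul_right (hclosed _ isClosed_closure hs) _).trans ?_
    rw [← mul_assoc, ENNReal.inv_mul_cancel hc ENNReal.ofReal_ne_top, one_mul]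
  have h2 : ν = ENNReal.ofReal (C₀ * σ) • ((ENNReal.ofReal (C₀ * σ))⁻¹ • ν) := by
    rw [smul_smul, ENNReal.mul_inv_cancel hc ENNReal.ofReal_ne_top, one_smul]
  have h3 : ENNReal.ofReal (C₀ * b * σ) = ENNReal.ofReal (C₀ * σ) * ENNReal.ofReal b := by
    rw [← ENNReal.ofReal_mul (by positivity)]; congr 1; ring
  rw [h2, h3, ← smul_smul]
  refine Measure.le_intro fun s _ _ => ?_
  exact mul_le_mul_right ((hle s).trans (hbH s)) _

/-- The image of `dx ds` under the motion along the normals is controlled by the Lebesgue measure. -/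
theorem IsNormalFlow.map_prod_le (h : IsNormalFlow m L A σ) {σ₀ : ℝ}
    (hσ₀ : σ ≤ σ₀) :
    Measure.map (fun q : E × ℝ => q.1 + q.2 • m q.1)
      ((volume.restrict A).prod (volume.restrict (Set.Icc 0 σ))) ≤
        ENNReal.ofReal ((1 + σ₀ * L) ^ N * σ) • volume := by
  have hσ := h.pos
  have hm := h.lipschitz.continuous
  have hmeas : Measurable (fun q : E × ℝ => q.1 + q.2 • m q.1) := by
    refine Continuous.measurable ?_
    fun_prop
  refine Measure.le_intro fun B hB _ => ?_
  rw [Measure.map_apply hmeas hB, Measure.prod_apply_symm (hmeas hB)]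
  have hslice : ∀ s ∈ Set.Icc 0 σ, (volume.restrict A)
      ((fun x => (x, s)) ⁻¹' ((fun q : E × ℝ => q.1 + q.2 • m q.1) ⁻¹' B)) ≤
        ENNReal.ofReal ((1 + σ₀ * L) ^ N) * volume B := by
    intro s hs
    lift s to NNReal using hs.1
    -- As m is constant along each segment, this map undoes the motion by s; its Lipschitz constant
    -- controls the volume of the preimage of B.
    have hf : LipschitzWith (1 + s * L) (fun y => y - (s : ℝ) • m y) := by
      refine LipschitzWith.id.sub (LipschitzWith.of_dist_le_mul fun x y => ?_)
      rw [dist_smul₀, Real.norm_of_nonneg hs.1, NNReal.coe_mul, mul_assoc]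
      exact mul_le_mul_of_nonneg_left (h.lipschitz.dist_le_mul x y) hs.1
    have hsub : ((fun x => (x, (s : ℝ))) ⁻¹' ((fun q : E × ℝ => q.1 + q.2 • m q.1) ⁻¹' B)) ∩ A ⊆
        (fun y => y - (s : ℝ) • m y) '' B := by
      rintro x ⟨hx, hxA⟩
      exact ⟨_, hx, by simp only [h.field_eq x hxA s hs]; abel⟩
    rw [Measure.restrict_apply (measurable_prodMk_right (hmeas hB))]
    refine (measure_mono hsub).trans ((volume_image_le_of_lipschitzWith hf B).trans ?_)
    gcongr
    have hσ₀' : 0 ≤ σ₀ := hσ.le.trans hσ₀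
    rw [ENNReal.ofReal_pow (by positivity)]
    gcongr
    rw [← ENNReal.ofReal_coe_nnreal]
    refine ENNReal.ofReal_le_ofReal ?_
    push_cast
    have := hs.2
    gcongr
    linarith
  refine (setLIntegral_mono measurable_const hslice).trans ?_
  have hσ₀' : 0 ≤ σ₀ := hσ.le.trans hσ₀
  rw [setLIntegral_const, Real.volume_Icc, sub_zero, Measure.smul_apply, smul_eq_mul,
    ENNReal.ofReal_mul (by positivity), mul_right_comm]

end

section

variable {m : EuclideanSpace ℝ (Fin N) → EuclideanSpace ℝ (Fin N)} {L : NNReal}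
  {A : Set (EuclideanSpace ℝ (Fin N))} {σ : ℝ}

/-! ### Integrals along the normal segments -/

/-- The integral of `u` along the segment of length `σ` from `x` in the direction `m x`. -/
def segmentIntegral (m : EuclideanSpace ℝ (Fin N) → EuclideanSpace ℝ (Fin N)) (σ : ℝ)
    (u : EuclideanSpace ℝ (Fin N) → ℝ≥0∞) (x : EuclideanSpace ℝ (Fin N)) : ℝ≥0∞ :=
  ∫⁻ s in Set.Icc 0 σ, u (x + s • m x)

theorem IsNormalFlow.measurable (h : IsNormalFlow m L A σ) :
    Measurable (fun q : E × ℝ => q.1 + q.2 • m q.1) := by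
  have hm := h.lipschitz.continuous
  refine Continuous.measurable ?_
  fun_prop

/-- The push-forward of dx ds is absolutely continuous, so null sets of u do no harm. -/
theorem IsNormalFlow.aemeasurable_comp (h : IsNormalFlow m L A σ) {u : E → ℝ≥0∞}
    (hu : AEMeasurable u) : AEMeasurable (fun q : E × ℝ => u (q.1 + q.2 • m q.1))
      ((volume.restrict A).prod (volume.restrict (Set.Icc 0 σ))) :=
  (hu.mono_ac (Measure.absolutelyContinuous_of_le_smul (h.map_prod_le le_rfl))).comp_measurable
    h.measurable

theorem IsNormalFlow.aemeasurable_segmentIntegral (h : IsNormalFlow m L A σ) {u : E → ℝ≥0∞}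
    (hu : AEMeasurable u) : AEMeasurable (segmentIntegral m σ u) (volume.restrict A) :=
  (h.aemeasurable_comp hu).lintegral_prod_right'

theorem IsNormalFlow.ae_aemeasurable (h : IsNormalFlow m L A σ) {u : E → ℝ≥0∞}
    (hu : AEMeasurable u) : ∀ᵐ x ∂(volume.restrict A),
      AEMeasurable (fun s : ℝ => u (x + s • m x)) (volume.restrict (Set.Icc 0 σ)) :=
  ((h.aemeasurable_comp hu).aestronglyMeasurable.prodMk_left).mono fun _ hx => hx.aemeasurable

theorem IsNormalFlow.lintegral_lintegral_le (h : IsNormalFlow m L A σ) {σ₀ : ℝ} (hσ₀ : σ ≤ σ₀)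
    {u : E → ℝ≥0∞} (hu : AEMeasurable u) :
    ∫⁻ x in A, segmentIntegral m σ u x ≤
      ENNReal.ofReal ((1 + σ₀ * L) ^ N * σ) * ∫⁻ x, u x := by
  have hac := hu.mono_ac (Measure.absolutelyContinuous_of_le_smul (h.map_prod_le le_rfl))
  calc ∫⁻ x in A, segmentIntegral m σ u x
      = ∫⁻ q, u (q.1 + q.2 • m q.1) ∂((volume.restrict A).prod (volume.restrict (Set.Icc 0 σ))) :=
        (lintegral_prod _ (h.aemeasurable_comp hu)).symm
    _ = ∫⁻ y, u y ∂(Measure.map (fun q : E × ℝ => q.1 + q.2 • m q.1)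
          ((volume.restrict A).prod (volume.restrict (Set.Icc 0 σ)))) :=
        (lintegral_map' hac h.measurable.aemeasurable).symm
    _ ≤ ∫⁻ y, u y ∂(ENNReal.ofReal ((1 + σ₀ * L) ^ N * σ) • volume) :=
        lintegral_mono' (h.map_prod_le hσ₀) le_rfl
    _ = _ := by rw [lintegral_smul_measure, smul_eq_mul]

/-- For finite p, Hölder on a segment of length σ gives σ^(p-1) and the push-forward bound one more
σ; the p-th root leaves σ. For p = ∞ an essential bound transfers by absolute continuity. -/
theorem IsNormalFlow.eLpNorm_segmentIntegral_le (h : IsNormalFlow m L A σ) {σ₀ : ℝ}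
    (hσ₀ : σ ≤ σ₀) {u : E → ℝ≥0∞} (hu : AEMeasurable u) {p : ℝ≥0∞} (hp : 1 ≤ p) :
    eLpNorm (segmentIntegral m σ u) p (volume.restrict A) ≤
      ENNReal.ofReal ((1 + σ₀ * L) ^ N * σ) * eLpNorm u p volume := by
  have hσ := h.pos
  have hσ₀' : 0 ≤ σ₀ := hσ.le.trans hσ₀
  set c := ENNReal.ofReal ((1 + σ₀ * L) ^ N) with hc
  -- Ensures c^(1/p) ≤ c, so that the constant does not depend on p.
  have hc1 : 1 ≤ c := by
    rw [hc, ← ENNReal.ofReal_one]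
    refine ENNReal.ofReal_le_ofReal (one_le_pow₀ ?_)
    have : 0 ≤ σ₀ * L := by positivity
    linarith
  set a := ENNReal.ofReal σ with ha
  have hca : ENNReal.ofReal ((1 + σ₀ * L) ^ N * σ) = c * a :=
    ENNReal.ofReal_mul (by positivity)
  have hτ : (volume.restrict (Set.Icc 0 σ)) Set.univ = a := by simp [ha]
  have hane : a ≠ ⊤ := ENNReal.ofReal_ne_top
  have ha0 : a ≠ 0 := (ENNReal.ofReal_pos.2 hσ).ne'
  rcases eq_or_ne p ⊤ with rfl | hptop
  · rw [eLpNorm_exponent_top, eLpNorm_exponent_top, hca]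
    have h1 : ∀ᵐ q ∂((volume.restrict A).prod (volume.restrict (Set.Icc 0 σ))),
        u (q.1 + q.2 • m q.1) ≤ eLpNormEssSup u volume :=
      ae_of_ae_map h.measurable.aemeasurable
        ((Measure.absolutelyContinuous_of_le_smul (h.map_prod_le le_rfl)).ae_le
          ((ae_le_eLpNormEssSup (f := u)).mono fun x hx => by simpa using hx))
    refine eLpNormEssSup_le_of_ae_enorm_bound ?_
    filter_upwards [Measure.ae_ae_of_ae_prod h1] with x hx
    rw [enorm_eq_self, segmentIntegral]
    refine (lintegral_mono_ae hx).trans ?_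
    rw [lintegral_const, hτ, mul_comm]
    gcongr
    exact le_mul_of_one_le_left zero_le hc1
  · have hp0 : p ≠ 0 := (zero_lt_one.trans_le hp).ne'
    set r := p.toReal with hr
    have hr1 : 1 ≤ r := by
      rw [hr, ← ENNReal.toReal_one]; exact ENNReal.toReal_mono hptop hp
    have hr0 : 0 < r := by linarith
    have hslice : ∀ᵐ x ∂(volume.restrict A),
        segmentIntegral m σ u x ^ r ≤ segmentIntegral m σ (fun y => u y ^ r) x * a ^ (r - 1) := by
      filter_upwards [h.ae_aemeasurable hu] with x hx
      have h1 := eLpNorm_le_eLpNorm_mul_rpow_measure_univ hp hx.aestronglyMeasurable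
      rw [eLpNorm_one_eq_lintegral_enorm, eLpNorm_eq_lintegral_rpow_enorm_toReal hp0 hptop, hτ,
        ← hr] at h1
      simp only [enorm_eq_self, ENNReal.toReal_one, div_one] at h1
      refine (ENNReal.rpow_le_rpow h1 hr0.le).trans_eq ?_
      rw [ENNReal.mul_rpow_of_nonneg _ _ hr0.le, ← ENNReal.rpow_mul, ← ENNReal.rpow_mul,
        one_div_mul_cancel hr0.ne', ENNReal.rpow_one, sub_mul, one_mul,
        one_div_mul_cancel hr0.ne']
      rfl
    rw [eLpNorm_eq_lintegral_rpow_enorm_toReal hp0 hptop,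
      eLpNorm_eq_lintegral_rpow_enorm_toReal hp0 hptop, ← hr]
    simp only [enorm_eq_self]
    have hpow : a * a ^ (r - 1) = a ^ r := by
      have h1 := ENNReal.rpow_add 1 (r - 1) ha0 hane
      rwa [ENNReal.rpow_one, add_sub_cancel, eq_comm] at h1
    calc (∫⁻ x in A, segmentIntegral m σ u x ^ r) ^ (1 / r)
        ≤ (∫⁻ x in A, segmentIntegral m σ (fun y => u y ^ r) x * a ^ (r - 1)) ^ (1 / r) := by
          gcongr ?_ ^ _
          exact lintegral_mono_ae hslice
      _ = ((∫⁻ x in A, segmentIntegral m σ (fun y => u y ^ r) x) * a ^ (r - 1)) ^ (1 / r) := by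
          rw [lintegral_mul_const' _ _ (ENNReal.rpow_ne_top_of_nonneg (by linarith) hane)]
      _ ≤ ((c * a * ∫⁻ x, u x ^ r) * a ^ (r - 1)) ^ (1 / r) := by
          gcongr
          rw [← hca]
          exact h.lintegral_lintegral_le hσ₀ (hu.pow_const r)
      _ = (c * a ^ r * ∫⁻ x, u x ^ r) ^ (1 / r) := by
          rw [← hpow]; congr 1; ring
      _ = c ^ (1 / r) * a * (∫⁻ x, u x ^ r) ^ (1 / r) := by
          rw [ENNReal.mul_rpow_of_nonneg _ _ (by positivity),
            ENNReal.mul_rpow_of_nonneg _ _ (by positivity), ← ENNReal.rpow_mul,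
            mul_one_div_cancel hr0.ne', ENNReal.rpow_one]
      _ ≤ ENNReal.ofReal ((1 + σ₀ * L) ^ N * σ) * (∫⁻ x, u x ^ r) ^ (1 / r) := by
          rw [hca]
          gcongr
          conv_rhs => rw [← ENNReal.rpow_one c]
          exact ENNReal.rpow_le_rpow_of_exponent_le hc1 (by rw [div_le_one hr0]; exact hr1)

/-- The fundamental theorem of calculus along a normal segment. -/
theorem enorm_le_add_segmentIntegral {φ : E → ℝ} (hφ : ContDiff ℝ ∞ φ) {A₀ : Set E} {x : E} {S : ℝ}
    (hS : S ∈ Set.Icc 0 σ) (hm : ∀ s ∈ Set.Icc 0 σ, m (x + s • m x) = m x)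
    (hA₀ : ∀ s, 0 ≤ s → s < S → x + s • m x ∈ A₀) :
    ‖φ x‖ₑ ≤ ‖φ (x + S • m x)‖ₑ +
      segmentIntegral m σ (A₀.indicator fun y => ‖(inner ℝ (m y) (gradient φ y) : ℝ)‖ₑ) x := by
  have hc : Continuous fun s : ℝ => (inner ℝ (gradient φ (x + s • m x)) (m x) : ℝ) := by
    have := (ContDiff.gradient hφ).continuous
    fun_prop
  have h1 : ∫ s in (0 : ℝ)..S, (inner ℝ (gradient φ (x + s • m x)) (m x) : ℝ) =
      φ (x + S • m x) - φ x := by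
    rw [intervalIntegral.integral_eq_sub_of_hasDerivAt
      (fun s _ => hasDerivAt_comp_line hφ x (m x) s) (hc.intervalIntegrable _ _)]
    simp
  have h2 : φ x = φ (x + S • m x) -
      ∫ s in Set.Ioo 0 S, (inner ℝ (gradient φ (x + s • m x)) (m x) : ℝ) := by
    rw [← integral_Ioc_eq_integral_Ioo, ← intervalIntegral.integral_of_le hS.1, h1]; ring
  rw [h2]
  refine (enorm_sub_le).trans ?_
  gcongr
  refine (enorm_integral_le_lintegral_enorm _).trans ?_
  rw [segmentIntegral]
  calc ∫⁻ s in Set.Ioo 0 S, ‖(inner ℝ (gradient φ (x + s • m x)) (m x) : ℝ)‖ₑ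
      = ∫⁻ s in Set.Ioo 0 S, A₀.indicator (fun y => ‖(inner ℝ (m y) (gradient φ y) : ℝ)‖ₑ)
          (x + s • m x) := by
        refine setLIntegral_congr_fun measurableSet_Ioo fun s hs => ?_
        rw [Set.indicator_of_mem (hA₀ s hs.1.le hs.2), hm s ⟨hs.1.le, hs.2.le.trans hS.2⟩,
          real_inner_comm]
    _ ≤ _ := lintegral_mono_set (Set.Ioo_subset_Icc_self.trans (Set.Icc_subset_Icc_right hS.2))

/-! ### The exit point -/

/-- The time at which the ray from `x` in the direction `m x` leaves `U`, capped at `R`. -/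
def exitTime (m : EuclideanSpace ℝ (Fin N) → EuclideanSpace ℝ (Fin N))
    (U : Set (EuclideanSpace ℝ (Fin N))) (R : ℝ) (x : EuclideanSpace ℝ (Fin N)) : ℝ :=
  sInf {s | 0 ≤ s ∧ (R ≤ s ∨ x + s • m x ∉ U)}

variable {U : Set (EuclideanSpace ℝ (Fin N))} {R : ℝ}

theorem exitTime_nonneg (x : E) : 0 ≤ exitTime m U R x :=
  Real.sInf_nonneg fun _ h => h.1

theorem exitTime_le_of_or {x : E} {s : ℝ} (h0 : 0 ≤ s) (h : R ≤ s ∨ x + s • m x ∉ U) :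
    exitTime m U R x ≤ s :=
  csInf_le (s := {s | 0 ≤ s ∧ (R ≤ s ∨ x + s • m x ∉ U)}) ⟨0, fun _ h => h.1⟩ ⟨h0, h⟩

theorem exitTime_le (hR : 0 ≤ R) (x : E) : exitTime m U R x ≤ R :=
  exitTime_le_of_or hR (Or.inl le_rfl)

theorem mem_of_lt_exitTime {x : E} {s : ℝ} (h0 : 0 ≤ s) (hs : s < exitTime m U R x) :
    x + s • m x ∈ U := by
  by_contra h
  exact absurd (exitTime_le_of_or h0 (Or.inr h)) (not_le.2 hs)

theorem isClosed_exitTimes (hU : IsOpen U) (x : E) :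
    IsClosed {s : ℝ | 0 ≤ s ∧ (R ≤ s ∨ x + s • m x ∉ U)} := by
  refine (isClosed_le continuous_const continuous_id).inter ((isClosed_le continuous_const
    continuous_id).union (hU.isClosed_compl.preimage (f := fun s : ℝ => x + s • m x) ?_))
  fun_prop

theorem notMem_of_exitTime_lt (hU : IsOpen U) (hR : 0 ≤ R) {x : E} (h : exitTime m U R x < R) :
    x + exitTime m U R x • m x ∉ U :=
  ((isClosed_exitTimes hU x).csInf_mem ⟨R, hR, Or.inl le_rfl⟩ ⟨0, fun _ h => h.1⟩).2.resolve_left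
    (not_le.2 h)

/-- The exit time is lower semicontinuous: if the compact segment up to time a lies in the open set
U, so do the segments from nearby points. -/
theorem measurable_exitTime (hU : IsOpen U) (hR : 0 ≤ R) (hm : Continuous m) :
    Measurable (exitTime m U R) := by
  refine LowerSemicontinuous.measurable ?_
  intro x a ha
  rcases lt_or_ge a 0 with ha0 | ha0
  · exact Eventually.of_forall fun y => ha0.trans_le (exitTime_nonneg y)
  have h1 : ∀ᶠ y in 𝓝 x, ∀ s ∈ Set.Icc 0 a, y + s • m y ∈ U := by
    refine isCompact_Icc.eventually_forall_of_forall_eventually fun s hs => ?_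
    have hc : Continuous fun q : E × ℝ => q.1 + q.2 • m q.1 := by fun_prop
    exact hc.continuousAt.eventually
      (hU.mem_nhds (mem_of_lt_exitTime hs.1 (hs.2.trans_lt ha)))
  have haR : a < R := ha.trans_le (exitTime_le hR x)
  filter_upwards [h1] with y hy
  by_contra! hle
  obtain ⟨h2, h3⟩ := (isClosed_exitTimes (m := m) (R := R) hU y).csInf_mem
    ⟨R, hR, Or.inl le_rfl⟩ ⟨0, fun _ h => h.1⟩
  rcases h3 with h3 | h3
  · exact absurd (h3.trans hle) (not_le.2 haR)
  · exact h3 (hy _ ⟨h2, hle⟩)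

end

section

variable {m : EuclideanSpace ℝ (Fin N) → EuclideanSpace ℝ (Fin N)} {L : NNReal}
  {A : Set (EuclideanSpace ℝ (Fin N))} {σ : ℝ}

/-! ### The pointwise estimate for Sobolev functions -/

theorem segmentIntegral_mono {u w : E → ℝ≥0∞} (h : u ≤ w) (x : E) :
    segmentIntegral m σ u x ≤ segmentIntegral m σ w x :=
  lintegral_mono fun _ => h _

theorem segmentIntegral_add_le {u w : E → ℝ≥0∞} {x : E}
    (h : AEMeasurable (fun s : ℝ => u (x + s • m x)) (volume.restrict (Set.Icc 0 σ))) :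
    segmentIntegral m σ (u + w) x ≤ segmentIntegral m σ u x + segmentIntegral m σ w x :=
  (lintegral_add_left' h _).le

theorem map_le_surfaceMeasure {U : Set E} {S : E → ℝ} {c : ℝ≥0∞}
    (hmeas : Measurable (fun x => x + S x • m x))
    (hfr : ∀ᵐ x ∂(volume.restrict A), x + S x • m x ∈ frontier U)
    (hmap : Measure.map (fun x => x + S x • m x) (volume.restrict A) ≤
      c • Measure.euclideanHausdorffMeasure (N - 1)) :
    Measure.map (fun x => x + S x • m x) (volume.restrict A) ≤ c • surfaceMeasure U := by
  have hF : MeasurableSet (frontier U) := isClosed_frontier.measurableSet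
  have h1 : (Measure.map (fun x => x + S x • m x) (volume.restrict A)).restrict (frontier U) =
      Measure.map (fun x => x + S x • m x) (volume.restrict A) :=
    Measure.restrict_eq_self_of_ae_mem ((ae_map_iff hmeas.aemeasurable hF).2 hfr)
  rw [← h1, surfaceMeasure, ← Measure.restrict_smul]
  exact Measure.restrict_mono le_rfl hmap

/-- The smooth estimate for `φ k` costs three errors, each tending to 0 in L¹. In the application
`A` is the part of the skin `A₀` with travel time at most σ; the segments themselves are only known
to stay in `A₀`. -/
theorem IsNormalFlow.ae_enorm_le (h : IsNormalFlow m L A σ) (hA : MeasurableSet A)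
    {A₀ U : Set E} (hA₀ : MeasurableSet A₀) (hA₀U : A₀ ⊆ U)
    (hAA₀ : volume.restrict A = volume.restrict A₀) (hn : ∀ y ∈ A₀, ‖m y‖ ≤ 1) {S : E → ℝ}
    (hSm : Measurable S) (hS : ∀ x ∈ A, S x ∈ Set.Icc 0 σ)
    (hseg : ∀ x ∈ A, ∀ s, 0 ≤ s → s < S x → x + s • m x ∈ A₀) {c : ℝ≥0∞} (hc : c ≠ ⊤)
    (hmap : Measure.map (fun x => x + S x • m x) (volume.restrict A) ≤ c • surfaceMeasure U)
    {f g : E → ℝ} {Df : E → E} (hf : AEStronglyMeasurable f (volume.restrict U))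
    (hDf : AEStronglyMeasurable Df (volume.restrict U)) (htr : IsTrace U f Df g) :
    ∀ᵐ x ∂(volume.restrict A), ‖f x‖ₑ ≤ ‖g (x + S x • m x)‖ₑ +
      segmentIntegral m σ (A₀.indicator fun y => ‖(inner ℝ (m y) (Df y) : ℝ)‖ₑ) x := by
  obtain ⟨hg, φ, hφ, hφf, hφD, hφg⟩ := htr
  have hmc := h.lipschitz.continuous
  have hle : volume.restrict A ≤ volume.restrict U := by
    rw [hAA₀]; exact Measure.restrict_mono hA₀U le_rfl
  have hle₀ : volume.restrict A₀ ≤ volume.restrict U := Measure.restrict_mono hA₀U le_rfl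
  set e : E → E := fun x => x + S x • m x with he
  have hmeas : Measurable e := measurable_id.add (hSm.smul hmc.measurable)
  have hgm : AEStronglyMeasurable g (Measure.map e (volume.restrict A)) :=
    hg.mono_ac (Measure.absolutelyContinuous_of_le_smul hmap)
  have hge : AEStronglyMeasurable (g ∘ e) (volume.restrict A) := hgm.comp_measurable hmeas
  set u : E → ℝ≥0∞ := A₀.indicator fun y => ‖(inner ℝ (m y) (Df y) : ℝ)‖ₑ with hu
  have hum : AEMeasurable u := (aemeasurable_indicator_iff hA₀).2
    ((hmc.aestronglyMeasurable.inner (hDf.mono_measure hle₀)).enorm)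
  set w : ℕ → E → ℝ≥0∞ := fun k => A₀.indicator fun y => ‖gradient (φ k) y - Df y‖ₑ with hw
  have hwm : ∀ k, AEMeasurable (w k) := fun k => (aemeasurable_indicator_iff hA₀).2
    (((ContDiff.gradient (hφ k)).continuous.aestronglyMeasurable.sub
      (hDf.mono_measure hle₀)).enorm)
  have hDum := h.aemeasurable_segmentIntegral hum
  have hfm : AEMeasurable (fun x => ‖f x‖ₑ) (volume.restrict A) := (hf.mono_measure hle).enorm
  have hGm : AEMeasurable (fun x => ‖g (e x)‖ₑ + segmentIntegral m σ u x) (volume.restrict A) :=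
    hge.enorm.add hDum
  -- Truncated subtraction is the positive part; its integral will vanish in the limit.
  have hpt : ∀ k, ∀ᵐ x ∂(volume.restrict A),
      ‖f x‖ₑ - (‖g (e x)‖ₑ + segmentIntegral m σ u x) ≤
        ‖φ k x - f x‖ₑ + (‖φ k (e x) - g (e x)‖ₑ + segmentIntegral m σ (w k) x) := by
    intro k
    filter_upwards [h.ae_aemeasurable hum, ae_restrict_mem hA] with x hx hxA
    rw [tsub_le_iff_right]
    have h1 := enorm_le_add_segmentIntegral (hφ k) (hS x hxA)
      (fun s hs => h.field_eq x hxA s hs) (hseg x hxA)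
    have h2 : segmentIntegral m σ
        (A₀.indicator fun y => ‖(inner ℝ (m y) (gradient (φ k) y) : ℝ)‖ₑ) x ≤
        segmentIntegral m σ u x + segmentIntegral m σ (w k) x := by
      refine (segmentIntegral_mono (w := u + w k) (fun y => ?_) x).trans
        (segmentIntegral_add_le hx)
      by_cases hy : y ∈ A₀
      · simp only [hu, hw, Pi.add_apply, Set.indicator_of_mem hy]
        have h3 : (inner ℝ (m y) (gradient (φ k) y) : ℝ) =
            inner ℝ (m y) (Df y) + inner ℝ (m y) (gradient (φ k) y - Df y) := by
          rw [← inner_add_right, add_sub_cancel]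
        rw [h3]
        refine (enorm_add_le _ _).trans ?_
        gcongr
        rw [enorm_le_iff_norm_le]
        refine (norm_inner_le_norm _ _).trans ?_
        exact mul_le_of_le_one_left (norm_nonneg _) (hn y hy)
      · simp [hu, hw, hy]
    have h4 : ‖f x‖ₑ ≤ ‖φ k x - f x‖ₑ + ‖φ k x‖ₑ := by
      have : f x = φ k x - (φ k x - f x) := by ring
      conv_lhs => rw [this]
      rw [add_comm]
      exact enorm_sub_le
    have h5 : ‖φ k (e x)‖ₑ ≤ ‖φ k (e x) - g (e x)‖ₑ + ‖g (e x)‖ₑ := by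
      have : φ k (e x) = (φ k (e x) - g (e x)) + g (e x) := by ring
      conv_lhs => rw [this]
      exact enorm_add_le _ _
    calc ‖f x‖ₑ ≤ ‖φ k x - f x‖ₑ + (‖φ k (e x)‖ₑ + _) := h4.trans (by gcongr)
      _ ≤ ‖φ k x - f x‖ₑ + ((‖φ k (e x) - g (e x)‖ₑ + ‖g (e x)‖ₑ) +
          (segmentIntegral m σ u x + segmentIntegral m σ (w k) x)) := by gcongr
      _ = _ := by ring
  have hint : ∀ k, ∫⁻ x in A, (‖f x‖ₑ - (‖g (e x)‖ₑ + segmentIntegral m σ u x)) ≤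
      eLpNorm (fun x => φ k x - f x) 1 (volume.restrict U) +
        (c * eLpNorm (fun x => φ k x - g x) 1 (surfaceMeasure U) +
          ENNReal.ofReal ((1 + σ * L) ^ N * σ) *
            eLpNorm (fun x => gradient (φ k) x - Df x) 1 (volume.restrict U)) := by
    intro k
    have ha : AEMeasurable (fun x => ‖φ k x - f x‖ₑ) (volume.restrict A) :=
      ((hφ k).continuous.aestronglyMeasurable.sub (hf.mono_measure hle)).enorm
    have hbm : AEStronglyMeasurable (fun y => φ k y - g y) (Measure.map e (volume.restrict A)) :=
      (hφ k).continuous.aestronglyMeasurable.sub hgm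
    have hb : AEMeasurable (fun x => ‖φ k (e x) - g (e x)‖ₑ) (volume.restrict A) :=
      (hbm.comp_measurable hmeas).enorm
    refine (lintegral_mono_ae (hpt k)).trans ?_
    rw [lintegral_add_left' ha, lintegral_add_left' hb]
    gcongr
    · rw [eLpNorm_one_eq_lintegral_enorm]
      exact lintegral_mono' hle le_rfl
    · rw [← lintegral_map' hbm.enorm hmeas.aemeasurable, eLpNorm_one_eq_lintegral_enorm]
      refine (lintegral_mono' hmap le_rfl).trans_eq ?_
      rw [lintegral_smul_measure, smul_eq_mul]
    · refine (h.lintegral_lintegral_le le_rfl (hwm k)).trans ?_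
      gcongr
      rw [hw, lintegral_indicator hA₀, eLpNorm_one_eq_lintegral_enorm]
      exact lintegral_mono' hle₀ le_rfl
  have hlim : Tendsto (fun k => eLpNorm (fun x => φ k x - f x) 1 (volume.restrict U) +
        (c * eLpNorm (fun x => φ k x - g x) 1 (surfaceMeasure U) +
          ENNReal.ofReal ((1 + σ * L) ^ N * σ) *
            eLpNorm (fun x => gradient (φ k) x - Df x) 1 (volume.restrict U))) atTop (𝓝 0) := by
    have h1 := ENNReal.Tendsto.const_mul (a := c) hφg (Or.inr hc)
    have h2 := ENNReal.Tendsto.const_mul (a := ENNReal.ofReal ((1 + σ * L) ^ N * σ)) hφD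
      (Or.inr ENNReal.ofReal_ne_top)
    simpa using hφf.add (h1.add h2)
  have hzero : ∫⁻ x in A, (‖f x‖ₑ - (‖g (e x)‖ₑ + segmentIntegral m σ u x)) = 0 :=
    le_antisymm (ge_of_tendsto' hlim hint) zero_le
  filter_upwards [(lintegral_eq_zero_iff' (hfm.sub hGm)).1 hzero] with x hx
  exact tsub_eq_zero_iff_le.1 hx

/-- The `L^p` form of the estimate. -/
theorem IsNormalFlow.eLpNorm_le (h : IsNormalFlow m L A σ) (hA : MeasurableSet A)
    {A₀ U : Set E} (hA₀ : MeasurableSet A₀) (hA₀U : A₀ ⊆ U)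
    (hAA₀ : volume.restrict A = volume.restrict A₀) (hn : ∀ y ∈ A₀, ‖m y‖ ≤ 1) {S : E → ℝ}
    (hSm : Measurable S) (hS : ∀ x ∈ A, S x ∈ Set.Icc 0 σ)
    (hseg : ∀ x ∈ A, ∀ s, 0 ≤ s → s < S x → x + s • m x ∈ A₀) {c : ℝ≥0∞} (hc : c ≠ ⊤)
    (hc0 : c ≠ 0)
    (hmap : Measure.map (fun x => x + S x • m x) (volume.restrict A) ≤ c • surfaceMeasure U)
    {f g : E → ℝ} {Df : E → E} (hf : AEStronglyMeasurable f (volume.restrict U))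
    (hDf : AEStronglyMeasurable Df (volume.restrict U)) (htr : IsTrace U f Df g) {σ₀ : ℝ}
    (hσ₀ : σ ≤ σ₀) {p : ℝ≥0∞} (hp : 1 ≤ p) :
    eLpNorm f p (volume.restrict A₀) ≤ c ^ (1 / p.toReal) * eLpNorm g p (surfaceMeasure U) +
      ENNReal.ofReal ((1 + σ₀ * L) ^ N * σ) *
        eLpNorm (fun y => (inner ℝ (m y) (Df y) : ℝ)) p (volume.restrict A₀) := by
  have hmc := h.lipschitz.continuous
  have hle₀ : volume.restrict A₀ ≤ volume.restrict U := Measure.restrict_mono hA₀U le_rfl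
  set e : E → E := fun x => x + S x • m x with he
  have hmeas : Measurable e := measurable_id.add (hSm.smul hmc.measurable)
  have hgm : AEStronglyMeasurable g (Measure.map e (volume.restrict A)) :=
    htr.1.mono_ac (Measure.absolutelyContinuous_of_le_smul hmap)
  have hge : AEStronglyMeasurable (g ∘ e) (volume.restrict A) := hgm.comp_measurable hmeas
  set u : E → ℝ≥0∞ := A₀.indicator fun y => ‖(inner ℝ (m y) (Df y) : ℝ)‖ₑ with hu
  have hum : AEMeasurable u := (aemeasurable_indicator_iff hA₀).2
    ((hmc.aestronglyMeasurable.inner (hDf.mono_measure hle₀)).enorm)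
  have hae := h.ae_enorm_le hA hA₀ hA₀U hAA₀ hn hSm hS hseg hc hmap hf hDf htr
  rw [← hAA₀]
  calc eLpNorm f p (volume.restrict A)
      ≤ eLpNorm ((fun x => ‖(g ∘ e) x‖ₑ) + segmentIntegral m σ u) p (volume.restrict A) := by
        refine eLpNorm_mono_enorm_ae ?_
        filter_upwards [hae] with x hx
        rw [enorm_eq_self]
        exact hx
    _ ≤ eLpNorm (fun x => ‖(g ∘ e) x‖ₑ) p (volume.restrict A) +
          eLpNorm (segmentIntegral m σ u) p (volume.restrict A) :=
        eLpNorm_add_le hge.enorm.aestronglyMeasurable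
          (h.aemeasurable_segmentIntegral hum).aestronglyMeasurable hp
    _ ≤ _ := by
        gcongr
        · rw [eLpNorm_enorm, ← eLpNorm_map_measure hgm hmeas.aemeasurable]
          refine (eLpNorm_mono_measure g hmap).trans_eq ?_
          rw [eLpNorm_smul_measure_of_ne_zero hc0, smul_eq_mul, ENNReal.toReal_div,
            ENNReal.toReal_one]
        · refine (h.eLpNorm_segmentIntegral_le hσ₀ hum hp).trans ?_
          rw [hAA₀, hu, eLpNorm_indicator_eq_eLpNorm_restrict hA₀, eLpNorm_enorm]

end

section

/-! ### The boundary skin of a polyhedral domain -/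

variable {Ω U : Set (EuclideanSpace ℝ (Fin N))} {R κ : ℝ} {L : NNReal}
  {m : EuclideanSpace ℝ (Fin N) → EuclideanSpace ℝ (Fin N)}

/-- The normal coordinate grows from t ≥ 0 along the ray, so Ω is not entered. Until the exit the
ray stays in the skin, hence in the tube of radius R/4; so the cap R/2 is never reached and the exit
is genuine. -/
theorem IsTubularData.exists_exit (hT : IsTubularData Ω R κ L m) (hU : IsOpen U)
    (hsub : U \ Ω ⊆ tube Ω (R / 4)) {x : E} (hx : x ∈ U \ Ω) :
    ∃ y ∈ frontier Ω, ∃ t, 0 ≤ t ∧ t + exitTime m U (R / 2) x ≤ R / 4 ∧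
      x = y + t • outwardNormal Ω y ∧ m x = outwardNormal Ω y ∧
      x + exitTime m U (R / 2) x • m x ∈ frontier U ∧
      ∀ s, 0 ≤ s → s < exitTime m U (R / 2) x → x + s • m x ∈ U \ Ω := by
  have hR := hT.pos
  obtain ⟨y, hy, t, ht, rfl⟩ := hT.exists_rep x (R / 4) (by linarith) (by linarith) (hsub hx)
  have htR : |t| ≤ R := by linarith
  have ht0 : 0 ≤ t := not_lt.1 fun h => hx.2 ((hT.mem_iff y hy t htR).2 h)
  rw [abs_of_nonneg ht0] at ht
  have hmx := hT.field_eq y hy t htR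
  set x := y + t • outwardNormal Ω y with hxdef
  set S := exitTime m U (R / 2) x with hS
  have hS0 : 0 ≤ S := exitTime_nonneg x
  have hSR : S ≤ R / 2 := exitTime_le (by linarith) x
  have hray : ∀ s, x + s • m x = y + (t + s) • outwardNormal Ω y := by
    intro s; rw [hmx, hxdef, add_smul, add_assoc]
  have hseg : ∀ s, 0 ≤ s → s < S → x + s • m x ∈ U \ Ω := by
    intro s hs0 hs
    refine ⟨mem_of_lt_exitTime hs0 hs, ?_⟩
    rw [hray, hT.mem_iff y hy _ (by rw [abs_of_nonneg (by positivity)]; linarith)]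
    exact not_lt.2 (by positivity)
  have hbound : ∀ s, 0 ≤ s → s < S → t + s ≤ R / 4 := by
    intro s hs0 hs
    have h1 := (mem_tube_iff ⟨y, hy⟩ (by linarith) _).1 (hsub (hseg s hs0 hs))
    rw [hray, hT.infDist_eq y hy _ (by rw [abs_of_nonneg (by positivity)]; linarith),
      abs_of_nonneg (by positivity)] at h1
    exact h1
  have htS : t + S ≤ R / 4 := by
    by_contra! h
    have := hbound ((R / 4 - t + S) / 2) (by linarith) (by linarith)
    linarith
  have hnot : x + S • m x ∉ U := notMem_of_exitTime_lt hU (by linarith) (by linarith)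
  refine ⟨y, hy, t, ht0, htS, rfl, hmx, ?_, hseg⟩
  rw [hU.frontier_eq]
  refine ⟨?_, hnot⟩
  have hSpos : 0 < S := by
    refine hS0.lt_of_ne fun h => hnot ?_
    rw [← h, zero_smul, add_zero]
    exact hx.1
  have hc : Continuous fun s : ℝ => x + s • m x := by fun_prop
  refine mem_closure_of_tendsto ((hc.tendsto S).mono_left (nhdsWithin_le_nhds (s := Set.Iio S))) ?_
  filter_upwards [Ico_mem_nhdsLT hSpos] with s hs
  exact (hseg s hs.1 hs.2).1

theorem IsTubularData.isNormalFlow (hT : IsTubularData Ω R κ L m) (hU : IsOpen U)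
    (hsub : U \ Ω ⊆ tube Ω (R / 4)) {A : Set E} (hA : A ⊆ U \ Ω) {σ : ℝ} (hσ : 0 < σ)
    (hσR : σ ≤ R / 2) : IsNormalFlow m L A σ where
  lipschitz := hT.lipschitz
  pos := hσ
  norm_le x hx := by
    obtain ⟨y, hy, t, -, -, -, hm, -⟩ := hT.exists_exit hU hsub (hA hx)
    rw [hm, hT.norm_eq_one y hy]
  field_eq x hx s hs := by
    obtain ⟨y, hy, t, ht, htS, hxy, hm, -⟩ := hT.exists_exit hU hsub (hA hx)
    have hR := hT.pos
    have h0 : 0 ≤ exitTime m U (R / 2) x := exitTime_nonneg x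
    rw [hm, hxy, add_assoc, ← add_smul]
    refine hT.field_eq y hy _ ?_
    rw [abs_of_nonneg (add_nonneg ht hs.1)]
    linarith [hs.2]

/-- Almost every point of the skin leaves the polyhedral domain through a boundary face, and hence
after a time of order `h²`. -/
theorem IsTubularData.ae_exitTime_le (hT : IsTubularData Ω R κ L m) (hN : 1 ≤ N)
    (hΩ : IsOpen Ω) {c : ℝ} {K : Geometry.SimplicialComplex ℝ E} (hK : IsAdmissibleMesh Ω c K)
    (hsub : polyDomain K \ Ω ⊆ tube Ω (R / 4)) :
    ∀ᵐ x ∂(volume.restrict (polyDomain K \ Ω)),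
      exitTime m (polyDomain K) (R / 2) x ≤ 4 * κ * meshSize K ^ 2 := by
  have hR := hT.pos
  have hU : IsOpen (polyDomain K) := isOpen_polyDomain
  have hA : MeasurableSet (polyDomain K \ Ω) := hU.measurableSet.diff hΩ.measurableSet
  have hmc := hT.lipschitz.continuous
  have hSm : Measurable (exitTime m (polyDomain K) (R / 2)) :=
    measurable_exitTime hU (by linarith) hmc
  have hflow := hT.isNormalFlow hU hsub subset_rfl (σ := R / 2) (by linarith) le_rfl
  have hmeas : Measurable (fun x => x + exitTime m (polyDomain K) (R / 2) x • m x) :=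
    measurable_id.add (hSm.smul hmc.measurable)
  -- A crude first use with travel time R/2, only for absolute continuity: almost no point exits
  -- through the skeleton.
  obtain ⟨C, -, hC⟩ := exists_map_le_euclideanHausdorffMeasure hN L (R / 2)
  have hmap := hC m _ _ _ hflow le_rfl hSm
    fun x _ => ⟨exitTime_nonneg x, exitTime_le (by linarith) x⟩
  have hskel : ∀ᵐ x ∂(volume.restrict (polyDomain K \ Ω)),
      x + exitTime m (polyDomain K) (R / 2) x • m x ∉ lowSkeleton K := by
    refine ae_of_ae_map (p := fun z => z ∉ lowSkeleton K) hmeas.aemeasurable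
      ((Measure.absolutelyContinuous_of_le_smul hmap).ae_le ?_)
    exact measure_eq_zero_iff_ae_notMem.1 (euclideanHausdorffMeasure_lowSkeleton hK.finite)
  filter_upwards [hskel, ae_restrict_mem hA] with x hx hxA
  obtain ⟨y, hy, t, ht, htS, hxy, hm, hfr, -⟩ := hT.exists_exit hU hsub hxA
  obtain ⟨s, hs, hxs⟩ := exists_boundaryFace hK.finite hK.pure hfr hx
  have h0 : 0 ≤ exitTime m (polyDomain K) (R / 2) x := exitTime_nonneg x
  have hray : x + exitTime m (polyDomain K) (R / 2) x • m x =
      y + (t + exitTime m (polyDomain K) (R / 2) x) • outwardNormal Ω y := by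
    rw [hm, add_smul, ← add_assoc, ← hxy]
  rw [hray] at hxs
  have h1 := hT.abs_le_of_mem_boundaryFace (hK.boundary s hs)
    (fun z hz v hv => hK.diam_le hs.1 (subset_convexHull ℝ _ hv) hz) hy
    (by rw [abs_of_nonneg (by positivity)]; linarith) hxs
  rw [abs_of_nonneg (by positivity)] at h1
  linarith

/-- The estimate on the boundary skin with `σ = 4κh²` in place of `δ`. -/
theorem IsTubularData.exists_eLpNorm_le (hT : IsTubularData Ω R κ L m) (hN : 1 ≤ N)
    (hΩ : IsOpen Ω) :
    ∃ C₁ C₂ : ℝ, 0 < C₁ ∧ 0 < C₂ ∧ ∀ (c : ℝ) (K : Geometry.SimplicialComplex ℝ E),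
      IsAdmissibleMesh Ω c K → polyDomain K \ Ω ⊆ tube Ω (R / 4) →
      ∀ σ, σ = 4 * κ * meshSize K ^ 2 → σ ≤ R / 2 →
      ∀ (p : ℝ≥0∞) (f : E → ℝ) (Df : E → E) (g : E → ℝ), 1 ≤ p →
        IsSobolev (polyDomain K) p f Df → IsTrace (polyDomain K) f Df g →
        eLpNorm f p (volume.restrict (polyDomain K \ Ω)) ≤
          ENNReal.ofReal (C₁ * σ) ^ (1 / p.toReal) *
              eLpNorm g p (surfaceMeasure (polyDomain K)) +
            ENNReal.ofReal (C₂ * σ) *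
              eLpNorm (fun y => (inner ℝ (m y) (Df y) : ℝ)) p
                (volume.restrict (polyDomain K \ Ω)) := by
  have hR := hT.pos
  obtain ⟨C₁, hC₁, hC⟩ := exists_map_le_euclideanHausdorffMeasure hN L (R / 2)
  refine ⟨C₁, (1 + R / 2 * L) ^ N, hC₁, by positivity, ?_⟩
  intro c K hK hsub σ hσ hσR p f Df g hp hf htr
  have hU : IsOpen (polyDomain K) := isOpen_polyDomain
  have hA₀ : MeasurableSet (polyDomain K \ Ω) := hU.measurableSet.diff hΩ.measurableSet
  have hmc := hT.lipschitz.continuous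
  set S := exitTime m (polyDomain K) (R / 2) with hS
  have hSm : Measurable S := measurable_exitTime hU (by linarith) hmc
  have hσ0 : 0 < σ := by
    have := hK.meshSize_pos hN
    have := hT.K_pos
    rw [hσ]; positivity
  -- A part of full measure on which the flow time is σ, so that the constants scale with σ instead
  -- of R.
  set A := (polyDomain K \ Ω) ∩ {x | S x ≤ σ} with hAdef
  have hA : MeasurableSet A := hA₀.inter (hSm measurableSet_Iic)
  have hAsub : A ⊆ polyDomain K \ Ω := Set.inter_subset_left
  have hflow := hT.isNormalFlow hU hsub hAsub hσ0 hσR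
  have hAA₀ : volume.restrict A = volume.restrict (polyDomain K \ Ω) := by
    refine Measure.restrict_congr_set ?_
    refine (LE.le.eventuallyLE hAsub).antisymm ?_
    filter_upwards [(ae_restrict_iff' hA₀).1 (hT.ae_exitTime_le hN hΩ hK hsub)] with x hx hxA
    exact ⟨hxA, by rw [hσ]; exact hx hxA⟩
  have hSA : ∀ x ∈ A, S x ∈ Set.Icc 0 σ := fun x hx => ⟨exitTime_nonneg x, hx.2⟩
  have hmap := map_le_surfaceMeasure (U := polyDomain K)
    (measurable_id.add (hSm.smul hmc.measurable))
    ((ae_restrict_mem hA).mono fun x hx => by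
      obtain ⟨y, hy, t, -, -, -, -, hfr, -⟩ := hT.exists_exit hU hsub (hAsub hx)
      exact hfr) (hC m A σ S hflow hσR hSm hSA)
  refine hflow.eLpNorm_le hA hA₀ Set.sdiff_subset hAA₀ ?_ hSm hSA ?_ ENNReal.ofReal_ne_top
    (ENNReal.ofReal_pos.2 (by positivity)).ne' hmap hf.memLp.1 hf.memLp_grad.1 htr hσR hp
  · intro x hx
    obtain ⟨y, hy, t, -, -, -, hm, -⟩ := hT.exists_exit hU hsub hx
    rw [hm, hT.norm_eq_one y hy]
  · intro x hx
    obtain ⟨y, hy, t, -, -, -, -, -, hseg⟩ := hT.exists_exit hU hsub (hAsub hx)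
    exact hseg

/-- The exponent lies in [0, 1]. For p = ∞ it is 1/0 = 0, which matches the convention δ^(1/∞) = 1.
-/
theorem ofReal_mul_rpow_le {q δ : ℝ} (hq : 0 ≤ q) {p : ℝ≥0∞} (hp : 1 ≤ p) :
    ENNReal.ofReal (q * δ) ^ (1 / p.toReal) ≤
      ENNReal.ofReal (max 1 q) * ENNReal.ofReal δ ^ (1 / p.toReal) := by
  have h0 : 0 ≤ 1 / p.toReal := by positivity
  have h1 : 1 / p.toReal ≤ 1 := by
    rcases eq_or_ne p ⊤ with rfl | hptop
    · simp
    · have : 1 ≤ p.toReal := by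
        rw [← ENNReal.toReal_one]; exact ENNReal.toReal_mono hptop hp
      rw [div_le_one (by linarith)]
      exact this
  rw [ENNReal.ofReal_mul hq, ENNReal.mul_rpow_of_nonneg _ _ h0]
  gcongr
  have h2 : 1 ≤ ENNReal.ofReal (max 1 q) := by
    rw [← ENNReal.ofReal_one]; exact ENNReal.ofReal_le_ofReal (le_max_left _ _)
  calc ENNReal.ofReal q ^ (1 / p.toReal) ≤ ENNReal.ofReal (max 1 q) ^ (1 / p.toReal) := by
        gcongr; exact le_max_right _ _
    _ ≤ ENNReal.ofReal (max 1 q) ^ (1 : ℝ) := ENNReal.rpow_le_rpow_of_exponent_le h2 h1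
    _ = _ := ENNReal.rpow_one _

end

end BoundarySkin

end


/-! ### Choice of the constants and the final estimate -/

theorem lemmaA (N : ℕ) (hN : 1 ≤ N) (Ω : Set (EuclideanSpace ℝ (Fin N)))
    (hΩ : BoundarySkin.IsBoundedSmoothDomain Ω) :
    ∃ δ₀ : ℝ, 0 < δ₀ ∧ BoundarySkin.IsTubularRadius Ω δ₀ ∧
      ∀ c : ℝ, 0 < c → ∃ h₀ : ℝ, 0 < h₀ ∧
        ∀ κ : ℝ, 0 < κ → ∀ p : ℝ≥0∞, 1 ≤ p → ∃ C : ℝ, 0 < C ∧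
          ∀ K : Geometry.SimplicialComplex ℝ (EuclideanSpace ℝ (Fin N)),
            BoundarySkin.IsAdmissibleMesh Ω c K →
            BoundarySkin.meshSize K ≤ h₀ →
            BoundarySkin.polyDomain K \ Ω ⊆ BoundarySkin.tube Ω δ₀ →
            ∀ (f : EuclideanSpace ℝ (Fin N) → ℝ)
              (Df : EuclideanSpace ℝ (Fin N) → EuclideanSpace ℝ (Fin N))
              (g : EuclideanSpace ℝ (Fin N) → ℝ),
              BoundarySkin.IsSobolev (BoundarySkin.polyDomain K) p f Df →
              BoundarySkin.IsTrace (BoundarySkin.polyDomain K) f Df g →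
              ∀ δ : ℝ, δ = κ * BoundarySkin.meshSize K ^ 2 →
                eLpNorm f p (volume.restrict (BoundarySkin.polyDomain K \ Ω)) ≤
                  ENNReal.ofReal C *
                    (ENNReal.ofReal δ ^ (1 / p.toReal) *
                        eLpNorm g p (BoundarySkin.surfaceMeasure (BoundarySkin.polyDomain K)) +
                      ENNReal.ofReal δ *
                        eLpNorm
                          (fun x => inner ℝ
                            (BoundarySkin.outwardNormal Ω (BoundarySkin.proj Ω δ₀ x)) (Df x))
                          p (volume.restrict (BoundarySkin.polyDomain K \ Ω))) := by
  obtain ⟨R, M, L, m, hT⟩ := hΩ.exists_isTubularData hN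
  have hR := hT.pos
  have hM := hT.K_pos
  obtain ⟨C₁, C₂, hC₁, hC₂, hC⟩ := hT.exists_eLpNorm_le hN hΩ.isOpen
  -- With δ₀ = R/4, rays followed for time up to R/2 keep normal coordinate below R.
  refine ⟨R / 4, by positivity, hT.isTubularRadius _ (by positivity) (by linarith), ?_⟩
  intro c _
  -- From h ≤ 1 and 8Mh ≤ R follows 4Mh² ≤ R/2, independently of κ.
  refine ⟨min 1 (R / (8 * M)), by positivity, ?_⟩
  intro κ hκ p hp
  -- The ratio of the travel time bound 4Mh² to δ = κh².
  set q := 4 * M / κ with hq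
  refine ⟨max (max 1 (C₁ * q)) (C₂ * q), by positivity, ?_⟩
  intro K hK hh hsub f Df g hf htr δ hδ
  have hh0 := hK.meshSize_pos hN
  have hσδ : 4 * M * BoundarySkin.meshSize K ^ 2 = q * δ := by
    rw [hδ, hq]; field_simp
  have hσR : 4 * M * BoundarySkin.meshSize K ^ 2 ≤ R / 2 := by
    have h1 : BoundarySkin.meshSize K ≤ 1 := hh.trans (min_le_left _ _)
    have h2 : BoundarySkin.meshSize K * (8 * M) ≤ R := by
      rw [← le_div_iff₀ (by positivity)]; exact hh.trans (min_le_right _ _)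
    nlinarith [mul_le_mul_of_nonneg_left h1 (by positivity : 0 ≤ M * BoundarySkin.meshSize K)]
  have hmain := hC c K hK hsub _ rfl hσR p f Df g hp hf htr
  rw [hσδ] at hmain
  have hn : eLpNorm (fun x => (inner ℝ
      (BoundarySkin.outwardNormal Ω (BoundarySkin.proj Ω (R / 4) x)) (Df x) : ℝ)) p
      (volume.restrict (BoundarySkin.polyDomain K \ Ω)) =
      eLpNorm (fun x => (inner ℝ (m x) (Df x) : ℝ)) p
      (volume.restrict (BoundarySkin.polyDomain K \ Ω)) := by
    refine eLpNorm_congr_ae ?_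
    filter_upwards [ae_restrict_mem (BoundarySkin.isOpen_polyDomain.measurableSet.diff
      hΩ.isOpen.measurableSet)] with x hx
    rw [hT.outwardNormal_proj (R / 4) (by positivity) (by linarith) x (hsub hx)]
  rw [hn]
  refine hmain.trans ?_
  rw [mul_add]
  refine add_le_add ?_ ?_
  · rw [← mul_assoc C₁, ← mul_assoc (ENNReal.ofReal _)]
    gcongr
    refine (BoundarySkin.ofReal_mul_rpow_le (by positivity) hp).trans ?_
    exact mul_le_mul' (ENNReal.ofReal_le_ofReal (le_max_left _ _)) le_rfl
  · rw [← mul_assoc C₂, ← mul_assoc (ENNReal.ofReal _), ENNReal.ofReal_mul (by positivity)]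
    exact mul_le_mul' (mul_le_mul' (ENNReal.ofReal_le_ofReal (le_max_right _ _)) le_rfl) le_rfl
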